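/- Let $\Omega\subset\mathbb R^n$ be a domain and let $E$ be a bounded open set with $\overline E\subset\Omega$. Let $Q$ be a function on $\Omega$ with Lebesgue measurable entries whose values are symmetric positive semidefinite real $n\times n$ matrices, $\mathcal Q(x,\xi)=\xi^tQ(x)\xi=|\sqrt{Q(x)}\,\xi|^2$, and $\gamma(x)=|Q(x)|_{\mathrm{op}}$. Let $v\ge 0$ be a weight in $L^1_{\mathrm{loc}}(\Omega)$. Let $1<p<\infty$. Notation. $L^p(v;E)$ has the norm $\|f\|_{L^p(v;E)}=(\int_E|f|^pv\,dx)^{1/p}$, and $f_E=\frac1{v(E)}\int_E f v\,dx$, where $v(E)=\int_E v\,dx$ (if $v(E)=0$, put $f_E=0$). $\mathcal L^p_Q(E)$ is the space of measurable $\mathbf g:E\to\mathbb R^n$ with $\|\mathbf g\|_{\mathcal L^p_Q(E)}=(\int_E\mathcal Q(x,\mathbf g(x))^{p/2}dx)^{1/p}<\infty$, where $\mathbf g$ and $\mathbf h$ are identified if $\|\mathbf g-\mathbf h\|_{\mathcal L^p_Q(E)}=0$. $C^1(\overline E)$ is the set of $f\in C^1(E)$ such that $f$ and $\nabla f$ extend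 continuously to $\overline E$. $H^{1,p}_Q(v;E)$ is the completion of the set of $f\in C^1(\overline E)$ with finite norm $\|f\|_{L^p(v;E)}+\|\nabla f\|_{\mathcal L^p_Q(E)}$; its elements are represented by pairs $(u,\mathbf g)\in L^p(v;E)\times\mathcal L^p_Q(E)$ which are limits of $(\varphi_k,\nabla\varphi_k)$ for sequences $\varphi_k$ of such functions. $\tilde H^{1,p}_Q(v;E)$ is the set of $(u,\mathbf g)\in H^{1,p}_Q(v;E)$ with $\int_E uv\,dx=0$. Given $f\in L^p(v;E)$, a pair $(u,\mathbf g)\in\tilde H^{1,p}_Q(v;E)$ is a weak solution, with datum $f$, of the Neumann problem $$\operatorname{div}\big(|\sqrt Q\nabla u|^{p-2}Q\nabla u\big)=|f|^{p-2}fv\ \text{ in }E,\qquad \mathbf n^tQ\nabla u=0\ \text{ on }\partial E$$ if $$\int_E|\sqrt{Q}\,\mathbf g|^{p-2}(\nabla\varphi)^tQ\,\mathbf g\,dx=-\int_E|f|^{p-2}f\varphi v\,dx$$ for all $\varphi\in C^1(\overline E)$ with $\|\nabla\varphi\|_{\mathcal L^p_Q(E)}<\infty$ and $\int_E\varphi v\,dx=0$.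 (Expressions $|s|^{p-2}s$ are read as $0$ at $s=0$.) $\mathcal Q$ has the $p$-Neumann property on $E$ if (1) for every $f\in L^p(v;E)$ there is such a weak solution, and (2) there is a constant $C>0$ such that $\|u\|_{L^p(v;E)}\le C\|f\|_{L^p(v;E)}$ for every $f\in L^p(v;E)$ and every weak solution $(u,\mathbf g)$ with datum $f$. $\mathcal Q$ has the Poincaré property of order $p$ on $E$ if there is a constant $C_p>0$ such that for all $f\in C^1(\overline E)$ $$\int_E|f-f_E|^pv\,dx\le C_p\int_E\mathcal Q(x,\nabla f(x))^{p/2}\,dx$$ (the right-hand side may be $+\infty$). Theorem. If $\gamma^{p/2}\in L^1_{\mathrm{loc}}(E)$, then $\mathcal Q$ has the $p$-Neumann property on $E$ if and only if $\mathcal Q$ has the Poincaré property of order $p$ on $E$. -/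

import Mathlib

open MeasureTheory Filter Topology Set
open scoped ENNReal Matrix

namespace DegenerateNeumann

noncomputable section

/-- `ℝⁿ` with its Euclidean norm. -/
abbrev Rn (n : ℕ) : Type := EuclideanSpace ℝ (Fin n)

/-- The bilinear form `ξᵗ Q(x) η`. -/
def bilinForm {n : ℕ} (Q : Rn n → Matrix (Fin n) (Fin n) ℝ) (x ξ η : Rn n) : ℝ :=
  ξ.ofLp ⬝ᵥ (Q x *ᵥ η.ofLp)

/-- The quadratic form `𝒬(x, ξ) = ξᵗ Q(x) ξ`. For `Q(x)` positive semidefinite this is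
`|√Q(x) ξ|²`, so that `|√Q(x) ξ| ^ r = 𝒬(x, ξ) ^ (r / 2)`. -/
def quadForm {n : ℕ} (Q : Rn n → Matrix (Fin n) (Fin n) ℝ) (x ξ : Rn n) : ℝ :=
  bilinForm Q x ξ ξ

/-- `γ(x) = |Q(x)|_op`, the Euclidean operator norm of `Q(x)`. -/
def gammaOp {n : ℕ} (Q : Rn n → Matrix (Fin n) (Fin n) ℝ) (x : Rn n) : ℝ :=
  ‖Matrix.toEuclideanCLM (n := Fin n) (𝕜 := ℝ) (Q x)‖

/-- The measure `v dx` on `E`. -/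
def weightMeasure {n : ℕ} (v : Rn n → ℝ) (E : Set (Rn n)) : Measure (Rn n) :=
  (volume.restrict E).withDensity (fun x => ENNReal.ofReal (v x))

/-- `f ∈ C¹(Ē)` for an open set `E`: `f` is continuously differentiable in `E`, and `f` and `∇f`
extend continuously to the closure of `E` (the values of `f` on `Ē` are those of the extension). -/
structure IsC1Closure {n : ℕ} (E : Set (Rn n)) (f : Rn n → ℝ) : Prop where
  contDiffOn : ContDiffOn ℝ 1 f E
  continuousOn : ContinuousOn f (closure E)
  gradient_extends : ∃ G : Rn n → Rn n, ContinuousOn G (closure E) ∧ EqOn (gradient f) G E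

/-- `∫_E 𝒬(x, g(x)) ^ (p / 2) dx`, with values in `[0, ∞]`. -/
def energyQ {n : ℕ} (Q : Rn n → Matrix (Fin n) (Fin n) ℝ) (p : ℝ) (E : Set (Rn n))
    (g : Rn n → Rn n) : ℝ≥0∞ :=
  ∫⁻ x in E, ENNReal.ofReal (quadForm Q x (g x)) ^ (p / 2)

/-- The norm of `𝓛^p_Q(E)`, with values in `[0, ∞]`. -/
def normLQ {n : ℕ} (Q : Rn n → Matrix (Fin n) (Fin n) ℝ) (p : ℝ) (E : Set (Rn n))
    (g : Rn n → Rn n) : ℝ≥0∞ :=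
  energyQ Q p E g ^ (1 / p)

/-- `g` is (a representative of) an element of `𝓛^p_Q(E)`: a Lebesgue measurable vector function
on `E` of finite norm. -/
def MemLQ {n : ℕ} (Q : Rn n → Matrix (Fin n) (Fin n) ℝ) (p : ℝ) (E : Set (Rn n))
    (g : Rn n → Rn n) : Prop :=
  AEMeasurable g (volume.restrict E) ∧ normLQ Q p E g < ∞

/-- `f ∈ L^p(v; E)`. -/
def MemLpWeight {n : ℕ} (v : Rn n → ℝ) (p : ℝ) (E : Set (Rn n)) (f : Rn n → ℝ) : Prop :=
  MemLp f (ENNReal.ofReal p) (weightMeasure v E)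

/-- The norm of `L^p(v; E)`, with values in `[0, ∞]`. -/
def normLpWeight {n : ℕ} (v : Rn n → ℝ) (p : ℝ) (E : Set (Rn n)) (f : Rn n → ℝ) : ℝ≥0∞ :=
  eLpNorm f (ENNReal.ofReal p) (weightMeasure v E)

/-- `φ ∈ C¹(Ē) ∩ H^{1,p}_Q(v; E)`: a function in `C¹(Ē)` whose Sobolev norm
`‖φ‖_{L^p(v; E)} + ‖∇φ‖_{𝓛^p_Q(E)}` is finite. -/
def IsC1Sobolev {n : ℕ} (Q : Rn n → Matrix (Fin n) (Fin n) ℝ) (v : Rn n → ℝ) (p : ℝ)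
    (E : Set (Rn n)) (φ : Rn n → ℝ) : Prop :=
  IsC1Closure E φ ∧ MemLpWeight v p E φ ∧ MemLQ Q p E (gradient φ)

/-- `(u, g)` is the pair in `L^p(v; E) × 𝓛^p_Q(E)` representing an element of `H^{1,p}_Q(v; E)`,
the completion of `C¹(Ē)` (functions of finite norm) in the Sobolev norm: `u` and `g` are the
limits of `φ k` and `∇(φ k)` for some sequence `φ` of such functions. -/
def MemSobolev {n : ℕ} (Q : Rn n → Matrix (Fin n) (Fin n) ℝ) (v : Rn n → ℝ) (p : ℝ)
    (E : Set (Rn n)) (u : Rn n → ℝ) (g : Rn n → Rn n) : Prop :=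
  MemLpWeight v p E u ∧ MemLQ Q p E g ∧
    ∃ φ : ℕ → Rn n → ℝ, (∀ k, IsC1Sobolev Q v p E (φ k)) ∧
      Tendsto (fun k => normLpWeight v p E (fun x => φ k x - u x)) atTop (𝓝 0) ∧
      Tendsto (fun k => normLQ Q p E (fun x => gradient (φ k) x - g x)) atTop (𝓝 0)

/-- The mean-zero Sobolev space `H̃^{1,p}_Q(v; E)`. -/
def MemSobolevMeanZero {n : ℕ} (Q : Rn n → Matrix (Fin n) (Fin n) ℝ) (v : Rn n → ℝ) (p : ℝ)
    (E : Set (Rn n)) (u : Rn n → ℝ) (g : Rn n → Rn n) : Prop :=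
  MemSobolev Q v p E u g ∧ ∫ x, u x ∂(weightMeasure v E) = 0

/-- `(u, g) ∈ H̃^{1,p}_Q(v; E)` is a weak solution, with datum `f`, of the weighted homogeneous
Neumann problem `div (|√Q ∇u| ^ (p - 2) Q ∇u) = |f| ^ (p - 2) f v` in `E`, `nᵗ Q ∇u = 0` on `∂E`.
The test functions are those of `C¹(Ē) ∩ H̃^{1,p}_Q(v; E)`. Both integrals converge absolutely,
by Hölder's inequality, when `1 < p` and `f ∈ L^p(v; E)`. -/
def IsWeakSolution {n : ℕ} (Q : Rn n → Matrix (Fin n) (Fin n) ℝ) (v : Rn n → ℝ) (p : ℝ)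
    (E : Set (Rn n)) (f u : Rn n → ℝ) (g : Rn n → Rn n) : Prop :=
  MemSobolevMeanZero Q v p E u g ∧
    ∀ φ : Rn n → ℝ, IsC1Sobolev Q v p E φ → ∫ x, φ x ∂(weightMeasure v E) = 0 →
      ∫ x in E, quadForm Q x (g x) ^ ((p - 2) / 2) * bilinForm Q x (gradient φ x) (g x) =
        -∫ x, |f x| ^ (p - 2) * f x * φ x ∂(weightMeasure v E)

/-- The Poincaré property of order `p` on `E`. The right-hand side may be infinite. -/
def HasPoincareProperty {n : ℕ} (Q : Rn n → Matrix (Fin n) (Fin n) ℝ) (v : Rn n → ℝ) (p : ℝ)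
    (E : Set (Rn n)) : Prop :=
  ∃ C : ℝ, 0 < C ∧ ∀ f : Rn n → ℝ, IsC1Closure E f →
    ∫⁻ x, ENNReal.ofReal (|f x - ⨍ y, f y ∂(weightMeasure v E)| ^ p) ∂(weightMeasure v E) ≤
      ENNReal.ofReal C * energyQ Q p E (gradient f)

/-- The `p`-Neumann property on `E`: every datum in `L^p(v; E)` has a weak solution, and all weak
solutions are bounded in `L^p(v; E)` by their data, with a uniform constant. -/
def HasNeumannProperty {n : ℕ} (Q : Rn n → Matrix (Fin n) (Fin n) ℝ) (v : Rn n → ℝ) (p : ℝ)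
    (E : Set (Rn n)) : Prop :=
  (∀ f : Rn n → ℝ, MemLpWeight v p E f → ∃ u g, IsWeakSolution Q v p E f u g) ∧
  ∃ C : ℝ, 0 < C ∧ ∀ f : Rn n → ℝ, MemLpWeight v p E f → ∀ u g, IsWeakSolution Q v p E f u g →
    normLpWeight v p E u ≤ ENNReal.ofReal C * normLpWeight v p E f

end

end DegenerateNeumann

/-! Write `h = √Q g`. A Sobolev pair then becomes a point `(u, h)` of `L^p(v) × L^p(dx; ℝⁿ)`, and
the mean-zero Sobolev space becomes the closure `M` of the pairs `(φ, √Q ∇φ)` with `φ` a mean-zero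
test function (`testPairs`). Matching the two descriptions requires recovering a measurable `g` from
a limit `h`, which is done with regularized inverses of `√Q` (`exists_aemeasurable_lift`). By
density, the Poincaré property says that `‖u‖ ≤ K ‖h‖` on `M` (`poincare_iff`), and the weak
equation says that `J(h)(b) = -J(f)(a)` for all `(a, b) ∈ M`, where `J` is the `L^p` duality map
`dualityMap` (`isWeakSolution_iff`).

Poincaré implies Neumann: the estimate makes `p⁻¹ ‖h‖ ^ p + J(f)(u)` coercive on `M`. Uniform
convexity of the `p`-th power makes minimizing sequences Cauchy, so a minimizer exists, and its
Euler–Lagrange equation is the weak equation. Testing any solution with itself gives the bound by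
the datum.

Neumann implies Poincaré: for `(a, b) ∈ M`, solve with datum `a`. Testing the solution with itself
bounds its energy by `‖a‖`; testing it with `(a, b)` turns the right-hand side into `-‖a‖ ^ p`, and
the two together bound `‖a‖` by `‖b‖`. -/

namespace DegenerateNeumann

/-! ### Uniform convexity of the `p`-th power of the norm. -/

section UniformConvexity

/-- Strictness has two sources: for equal norms, the strict triangle inequality of an inner product
space; for different norms, strict convexity of `t ^ p`. -/
lemma norm_midpoint_rpow_lt {H : Type*} [NormedAddCommGroup H] [InnerProductSpace ℝ H]
    {p : ℝ} (hp : 1 < p) {a b : H} (hab : a ≠ b) :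
    ‖(1 / 2 : ℝ) • (a + b)‖ ^ p < (‖a‖ ^ p + ‖b‖ ^ p) / 2 := by
  have hp0 : 0 < p := by linarith
  rw [norm_smul, Real.norm_of_nonneg (by norm_num)]
  by_cases h : ‖a‖ = ‖b‖
  · have h1 : ‖a + b‖ < ‖a‖ + ‖b‖ := by
      refine norm_add_lt_of_not_sameRay fun hs => hab ?_
      exact (sameRay_iff_of_norm_eq h).1 hs
    calc (1 / 2 * ‖a + b‖) ^ p < ‖a‖ ^ p :=
          Real.rpow_lt_rpow (by positivity) (by linarith) hp0
      _ = _ := by rw [h]; ring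
  · have h1 := (strictConvexOn_rpow hp).2 (norm_nonneg a) (norm_nonneg b) h
      (half_pos one_pos) (half_pos one_pos) (add_halves (1 : ℝ))
    simp only [smul_eq_mul] at h1
    calc (1 / 2 * ‖a + b‖) ^ p ≤ (1 / 2 * ‖a‖ + 1 / 2 * ‖b‖) ^ p :=
          Real.rpow_le_rpow (by positivity) (by linarith [norm_add_le a b]) hp0.le
      _ < _ := by linarith

/-- A quantitative form of the uniform convexity of `‖·‖ ^ p`, stable under integration. -/
def UniformlyConvexPower (p : ℝ) (Y : Type*) [NormedAddCommGroup Y] [NormedSpace ℝ Y] : Prop :=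
  ∀ ε : ℝ, 0 < ε → ∃ C : ℝ, 0 ≤ C ∧ ∀ a b : Y, ‖a - b‖ ^ p ≤ ε * (‖a‖ ^ p + ‖b‖ ^ p) +
    C * ((‖a‖ ^ p + ‖b‖ ^ p) / 2 - ‖(1 / 2 : ℝ) • (a + b)‖ ^ p)

/-- Both sides are homogeneous of degree `p`, so compactness of the unit sphere of `H × H` suffices.
-/
lemma uniformlyConvexPower_of_finiteDimensional {H : Type*} [NormedAddCommGroup H]
    [InnerProductSpace ℝ H] [FiniteDimensional ℝ H] {p : ℝ} (hp : 1 < p) :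
    UniformlyConvexPower p H := by
  intro ε hε
  have hp0 : 0 < p := by linarith
  have : ProperSpace (H × H) := FiniteDimensional.proper ℝ (H × H)
  let D : H × H → ℝ := fun z => (‖z.1‖ ^ p + ‖z.2‖ ^ p) / 2 - ‖(1 / 2 : ℝ) • (z.1 + z.2)‖ ^ p
  have hDc : Continuous D := by
    refine Continuous.sub (Continuous.div_const (Continuous.add ?_ ?_) _) ?_ <;>
      exact Continuous.rpow_const (by fun_prop) fun _ => Or.inr hp0.le
  have hD0 : ∀ z, 0 ≤ D z := by
    intro z
    by_cases h : z.1 = z.2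
    · have : (1 / 2 : ℝ) • (z.1 + z.2) = z.2 := by rw [h, ← two_smul ℝ, smul_smul]; norm_num
      have h2 : D z = 0 := by simp only [D]; rw [this, h]; ring
      exact h2.ge
    · exact sub_nonneg.2 (norm_midpoint_rpow_lt hp h).le
  let R : H × H → ℝ := fun z => ‖z.1 - z.2‖ ^ p
  have hRc : Continuous R := Continuous.rpow_const (by fun_prop) fun _ => Or.inr hp0.le
  let T : H × H → ℝ := fun z => ε * (‖z.1‖ ^ p + ‖z.2‖ ^ p)
  have hTc : Continuous T := by
    refine Continuous.mul continuous_const (Continuous.add ?_ ?_) <;>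
      exact Continuous.rpow_const (by fun_prop) fun _ => Or.inr hp0.le
  -- Off `K` the `ε` term alone suffices. On `K` the two components differ, so the convexity gap `D`
  -- has a positive minimum there.
  let K : Set (H × H) := Metric.sphere 0 1 ∩ {z | T z ≤ R z}
  have hK : IsCompact K := (isCompact_sphere _ _).inter_right (isClosed_le hTc hRc)
  obtain ⟨C, hC0, hC⟩ : ∃ C, 0 ≤ C ∧ ∀ z ∈ K, R z ≤ C * D z := by
    rcases K.eq_empty_or_nonempty with hKe | hKn
    · exact ⟨0, le_rfl, by simp [hKe]⟩
    obtain ⟨z₀, hz₀, hmin⟩ := hK.exists_isMinOn hKn hDc.continuousOn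
    obtain ⟨z₁, hz₁, hmax⟩ := hK.exists_isMaxOn hKn hRc.continuousOn
    have hpos : 0 < D z₀ := by
      refine sub_pos.2 (norm_midpoint_rpow_lt hp fun h => ?_)
      have h1 : T z₀ ≤ R z₀ := hz₀.2
      have h2 : R z₀ = 0 := by simp [R, h, hp0.ne']
      rw [h2] at h1
      have h4 : ‖z₀.2‖ ^ p ≤ 0 := by
        simp only [T, h] at h1
        have h5 : 0 ≤ ‖z₀.2‖ ^ p := by positivity
        by_contra! h6
        have : 0 < ε * (‖z₀.2‖ ^ p + ‖z₀.2‖ ^ p) := by positivity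
        linarith
      have h5 : ‖z₀.2‖ = 0 := by
        by_contra h6
        have : 0 < ‖z₀.2‖ ^ p := Real.rpow_pos_of_pos (lt_of_le_of_ne (norm_nonneg _) (Ne.symm h6)) _
        linarith
      have h6 : ‖z₀‖ = 1 := by simpa using hz₀.1
      rw [Prod.norm_def, h, h5] at h6
      simp at h6
    refine ⟨R z₁ / D z₀, div_nonneg (by positivity) hpos.le, fun z hz => ?_⟩
    calc R z ≤ R z₁ := hmax hz
      _ = R z₁ / D z₀ * D z₀ := by field_simp
      _ ≤ _ := mul_le_mul_of_nonneg_left (hmin hz) (div_nonneg (by positivity) hpos.le)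
  have key : ∀ z ∈ Metric.sphere (0 : H × H) 1, R z ≤ T z + C * D z := by
    intro z hz
    by_cases h : T z ≤ R z
    · have hT : 0 ≤ T z := by positivity
      linarith [hC z ⟨hz, h⟩]
    · have := mul_nonneg hC0 (hD0 z)
      linarith
  refine ⟨C, hC0, fun a b => ?_⟩
  by_cases h0 : (a, b) = (0 : H × H)
  · simp only [Prod.mk_eq_zero] at h0
    simp [h0.1, h0.2, hp0.ne']
  set r := ‖(a, b)‖ with hr
  have hrpos : 0 < r := norm_pos_iff.2 h0
  have hk := key (r⁻¹ • (a, b)) (by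
    rw [mem_sphere_zero_iff_norm, norm_smul, Real.norm_of_nonneg (by positivity), ← hr]
    field_simp)
  have hs : ∀ x : H, ‖r⁻¹ • x‖ ^ p = (r⁻¹) ^ p * ‖x‖ ^ p := fun x => by
    rw [norm_smul, Real.norm_of_nonneg (by positivity), Real.mul_rpow (by positivity) (norm_nonneg _)]
  simp only [R, T, D, Prod.smul_mk, ← smul_sub, ← smul_add, smul_comm (1 / 2 : ℝ) r⁻¹, hs] at hk
  have hpos : 0 < (r⁻¹) ^ p := by positivity
  refine le_of_mul_le_mul_left ?_ hpos
  linarith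

end UniformConvexity

/-! ### The direct method on a complete subspace. -/

section Minimization

variable {X Y : Type*} [NormedAddCommGroup X] [NormedSpace ℝ X] [NormedAddCommGroup Y]
  [NormedSpace ℝ Y]

/-- Coercivity: `t ^ p` with `p > 1` outgrows every linear term. -/
lemma exists_forall_rpow_div_sub_mul_le {p : ℝ} (hp : 1 < p) (c m : ℝ) :
    ∃ R : ℝ, 0 ≤ R ∧ ∀ t : ℝ, 0 ≤ t → t ^ p / p - c * t ≤ m → t ≤ R := by
  have h1 : Tendsto (fun t : ℝ => t * (t ^ (p - 1) / p - c)) atTop atTop := by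
    refine Tendsto.atTop_mul_atTop₀ tendsto_id ?_
    exact tendsto_atTop_add_const_right _ _
      ((tendsto_rpow_atTop (by linarith)).atTop_div_const (by linarith))
  obtain ⟨R, hR⟩ := ((h1.eventually_gt_atTop m).and (eventually_gt_atTop 0)).exists_forall_of_atTop
  refine ⟨max R 0, le_max_right _ _, fun t ht h => ?_⟩
  by_contra! hlt
  obtain ⟨h2, h3⟩ := hR t ((le_max_left _ _).trans hlt.le)
  have h4 : t ^ p = t * t ^ (p - 1) := by
    rw [Real.rpow_sub_one h3.ne']; field_simp
  rw [h4] at h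
  have : t * (t ^ (p - 1) / p - c) = t * t ^ (p - 1) / p - c * t := by ring
  linarith

/-- The functional `p⁻¹ ‖h‖ ^ p + ℓ u` attains its minimum on a complete subspace on which
`‖u‖` is controlled by `‖h‖`. -/
lemma exists_minimizer {p : ℝ} (hp : 1 < p) (hY : UniformlyConvexPower p Y)
    (M : Submodule ℝ (X × Y)) (hM : IsComplete (M : Set (X × Y))) (ℓ : X →L[ℝ] ℝ)
    {K : ℝ} (hK0 : 0 ≤ K) (hK : ∀ z ∈ M, ‖z.1‖ ≤ K * ‖z.2‖) :
    ∃ z ∈ M, ∀ w ∈ M, ‖z.2‖ ^ p / p + ℓ z.1 ≤ ‖w.2‖ ^ p / p + ℓ w.1 := by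
  have hp0 : 0 < p := by linarith
  set Φ : X × Y → ℝ := fun z => ‖z.2‖ ^ p / p + ℓ z.1 with hΦ
  have hΦc : Continuous Φ :=
    ((Continuous.rpow_const (by fun_prop) fun _ => Or.inr hp0.le).div_const _).add (by fun_prop)
  set c := ‖ℓ‖ * K
  have hc : 0 ≤ c := by positivity
  have hlow : ∀ z ∈ M, ‖z.2‖ ^ p / p - c * ‖z.2‖ ≤ Φ z := by
    intro z hz
    have h1 : |ℓ z.1| ≤ c * ‖z.2‖ := by
      calc |ℓ z.1| ≤ ‖ℓ‖ * ‖z.1‖ := ℓ.le_opNorm _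
        _ ≤ ‖ℓ‖ * (K * ‖z.2‖) := by gcongr; exact hK z hz
        _ = _ := by ring
    have := neg_abs_le (ℓ z.1)
    simp only [hΦ]; linarith
  have hbdd : BddBelow (Φ '' M) := by
    obtain ⟨R, hR0, hR⟩ := exists_forall_rpow_div_sub_mul_le hp c 0
    refine ⟨-(c * R), ?_⟩
    rintro _ ⟨z, hz, rfl⟩
    by_contra! h
    have hcR : 0 ≤ c * R := by positivity
    have h1 := hR ‖z.2‖ (norm_nonneg _) (by linarith [hlow z hz])
    have h2 : c * ‖z.2‖ ≤ c * R := by gcongr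
    have h3 : 0 ≤ ‖z.2‖ ^ p / p := by positivity
    linarith [hlow z hz]
  have hne : (Φ '' M).Nonempty := ⟨Φ 0, 0, M.zero_mem, rfl⟩
  set m := sInf (Φ '' M)
  have hm : ∀ z ∈ M, m ≤ Φ z := fun z hz => csInf_le hbdd ⟨z, hz, rfl⟩
  have hseq : ∀ k : ℕ, ∃ z ∈ M, Φ z < m + 1 / ((k : ℝ) + 1) := by
    intro k
    obtain ⟨_, ⟨z, hz, rfl⟩, h⟩ := exists_lt_of_csInf_lt hne
      (show m < m + 1 / ((k : ℝ) + 1) by linarith [Nat.one_div_pos_of_nat (α := ℝ) (n := k)])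
    exact ⟨z, hz, h⟩
  choose z hzM hz using hseq
  have hz1 : ∀ k, Φ (z k) ≤ m + 1 := fun k => (hz k).le.trans (by
    have : 1 / ((k : ℝ) + 1) ≤ 1 := (div_le_one (by positivity)).2 (by linarith [k.cast_nonneg (α := ℝ)])
    linarith)
  obtain ⟨R, hR0, hR⟩ := exists_forall_rpow_div_sub_mul_le hp c (m + 1)
  have hzR : ∀ k, ‖(z k).2‖ ^ p ≤ R ^ p := fun k => Real.rpow_le_rpow (norm_nonneg _)
    (hR _ (norm_nonneg _) ((hlow _ (hzM k)).trans (hz1 k))) hp0.le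
  -- The midpoint of two almost minimizers lies in `M`, so its value is at least `m`. The linear
  -- part `ℓ` cancels, and the convexity gap `A / p` is bounded by the distance to the infimum. The
  -- constants leave `δ ^ p / 2` for the `ε` term and `δ ^ p / 4` for `C * A`.
  have hcau2 : ∀ δ > 0, ∃ N, ∀ k ≥ N, ∀ l ≥ N, ‖(z k).2 - (z l).2‖ < δ := by
    intro δ hδ
    have hδp : 0 < δ ^ p := by positivity
    obtain ⟨C, hC0, hC⟩ := hY (δ ^ p / (4 * (R ^ p + 1))) (by positivity)
    obtain ⟨N, hN⟩ := exists_nat_one_div_lt (show 0 < δ ^ p / (4 * (C * p + 1)) by positivity)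
    refine ⟨N, fun k hk l hl => ?_⟩
    have hmid := hm _ (M.smul_mem (1 / 2 : ℝ) (M.add_mem (hzM k) (hzM l)))
    have hk1 : Φ (z k) < m + δ ^ p / (4 * (C * p + 1)) :=
      (hz k).trans (by linarith [Nat.one_div_le_one_div (α := ℝ) hk])
    have hl1 : Φ (z l) < m + δ ^ p / (4 * (C * p + 1)) :=
      (hz l).trans (by linarith [Nat.one_div_le_one_div (α := ℝ) hl])
    set A := (‖(z k).2‖ ^ p + ‖(z l).2‖ ^ p) / 2 - ‖(1 / 2 : ℝ) • ((z k).2 + (z l).2)‖ ^ p with hA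
    have hAle : A / p ≤ δ ^ p / (4 * (C * p + 1)) := by
      simp only [hΦ, Prod.smul_snd, Prod.snd_add, Prod.smul_fst, Prod.fst_add, map_smul,
        map_add, smul_eq_mul] at hmid hk1 hl1
      have : A / p = (‖(z k).2‖ ^ p / p + ‖(z l).2‖ ^ p / p) / 2 -
        ‖(1 / 2 : ℝ) • ((z k).2 + (z l).2)‖ ^ p / p := by rw [hA]; ring
      linarith
    have hCA : C * A ≤ δ ^ p / 4 := by
      calc C * A = C * p * (A / p) := by field_simp
        _ ≤ C * p * (δ ^ p / (4 * (C * p + 1))) := by gcongr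
        _ = (C * p) / (C * p + 1) * (δ ^ p / 4) := by field_simp
        _ ≤ 1 * (δ ^ p / 4) := by
            gcongr
            exact (div_le_one (by positivity)).2 (by linarith)
        _ = _ := one_mul _
    have h1 : δ ^ p / (4 * (R ^ p + 1)) * (‖(z k).2‖ ^ p + ‖(z l).2‖ ^ p) ≤ δ ^ p / 2 := by
      have hRp : 0 ≤ R ^ p := by positivity
      calc _ ≤ δ ^ p / (4 * (R ^ p + 1)) * (2 * (R ^ p + 1)) := by
            gcongr; linarith [hzR k, hzR l]
        _ = _ := by field_simp; ring
    have h2 := hC (z k).2 (z l).2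
    exact (Real.rpow_lt_rpow_iff (norm_nonneg _) hδ.le hp0).1
      ((h2.trans (add_le_add h1 hCA)).trans_lt (by linarith))
  -- Differences stay in `M`, so `hK` carries the Cauchy property from the second component to the
  -- first.
  have hcau : CauchySeq z := by
    rw [Metric.cauchySeq_iff]
    intro δ hδ
    obtain ⟨N, hN⟩ := hcau2 (δ / (K + 1)) (by positivity)
    refine ⟨N, fun k hk l hl => ?_⟩
    have h1 := hN k hk l hl
    have h2 := hK _ (M.sub_mem (hzM k) (hzM l))
    have h4 : (K + 1) * ‖(z k).2 - (z l).2‖ < δ := by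
      calc _ < (K + 1) * (δ / (K + 1)) := by gcongr
        _ = δ := by field_simp
    have h5 : 0 ≤ K * ‖(z k).2 - (z l).2‖ := by positivity
    rw [dist_eq_norm, Prod.norm_def, max_lt_iff]
    simp only [Prod.fst_sub, Prod.snd_sub] at h2 ⊢
    constructor <;> linarith [norm_nonneg ((z k).2 - (z l).2)]
  obtain ⟨z₀, hz₀, hlim⟩ := cauchySeq_tendsto_of_isComplete hM hzM hcau
  refine ⟨z₀, hz₀, fun w hw => ?_⟩
  have h1 : Tendsto (fun k => Φ (z k)) atTop (𝓝 (Φ z₀)) := (hΦc.tendsto z₀).comp hlim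
  have h2 : Φ z₀ ≤ m := by
    refine le_of_tendsto_of_tendsto' h1 ?_ fun k => (hz k).le
    simpa using tendsto_const_nhds.add (tendsto_one_div_add_atTop_nhds_zero_nat (𝕜 := ℝ))
  exact h2.trans (hm w hw)

end Minimization

/-! ### The derivative of `p⁻¹ ‖·‖ ^ p` on `L^p`. -/

section DualityMap

open scoped RealInnerProductSpace

variable {α : Type*} [MeasurableSpace α] {μ : Measure α} {H : Type*} [NormedAddCommGroup H]
  [InnerProductSpace ℝ H] {p : ℝ}

lemma abs_rpow_mul_inner_le (w b : H) (hp : 1 < p) :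
    |‖w‖ ^ (p - 2) * ⟪w, b⟫| ≤ ‖w‖ ^ (p - 1) * ‖b‖ := by
  rcases eq_or_ne w 0 with rfl | hw
  · simp [Real.zero_rpow (show p - 1 ≠ 0 by linarith)]
  have h : 0 < ‖w‖ := norm_pos_iff.2 hw
  calc |‖w‖ ^ (p - 2) * ⟪w, b⟫| = ‖w‖ ^ (p - 2) * |⟪w, b⟫| := by
        rw [abs_mul, abs_of_nonneg (by positivity)]
    _ ≤ ‖w‖ ^ (p - 2) * (‖w‖ * ‖b‖) := by gcongr; exact abs_real_inner_le_norm w b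
    _ = ‖w‖ ^ (p - 2 + 1) * ‖b‖ := by rw [Real.rpow_add_one h.ne']; ring
    _ = _ := by ring_nf

/-- A crude replacement for Young's inequality: it dominates mixed products by the `p`-th power of a
single `L^p` function. -/
lemma rpow_sub_one_mul_le {s t : ℝ} (hs : 0 ≤ s) (ht : 0 ≤ t) (hp : 1 < p) :
    s ^ (p - 1) * t ≤ (s + t) ^ p := by
  rcases (add_nonneg hs ht).eq_or_lt with h | h
  · have h1 : t = 0 := by linarith
    rw [h1, mul_zero]; positivity
  calc s ^ (p - 1) * t ≤ (s + t) ^ (p - 1) * (s + t) := by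
        gcongr <;> linarith
    _ = _ := by rw [← Real.rpow_add_one h.ne']; ring_nf

lemma integrable_norm_rpow_of_memLp (hp : 1 < p) {f : α → H} (hf : MemLp f (ENNReal.ofReal p) μ) :
    Integrable (fun x => ‖f x‖ ^ p) μ := by
  have := hf.integrable_norm_rpow (by simp; linarith) ENNReal.ofReal_ne_top
  rwa [ENNReal.toReal_ofReal (by linarith)] at this

lemma integrable_rpow_mul_inner (hp : 1 < p) {w b : α → H} (hw : MemLp w (ENNReal.ofReal p) μ)
    (hb : MemLp b (ENNReal.ofReal p) μ) :
    Integrable (fun x => ‖w x‖ ^ (p - 2) * ⟪w x, b x⟫) μ := by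
  refine (integrable_norm_rpow_of_memLp hp (hw.norm.add hb.norm)).mono' ?_ ?_
  · exact (hw.1.norm.aemeasurable.pow_const _).aestronglyMeasurable.mul (hw.1.inner hb.1)
  · refine Eventually.of_forall fun x => ?_
    rw [Real.norm_eq_abs]
    refine (abs_rpow_mul_inner_le _ _ hp).trans
      ((rpow_sub_one_mul_le (norm_nonneg _) (norm_nonneg _) hp).trans_eq ?_)
    simp only [Pi.add_apply]
    rw [Real.norm_of_nonneg (by positivity)]

lemma norm_Lp_rpow (hp : 1 < p) (f : Lp H (ENNReal.ofReal p) μ) :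
    ‖f‖ ^ p = ∫ x, ‖f x‖ ^ p ∂μ := by
  have hp0 : 0 < p := by linarith
  rw [Lp.norm_def, (Lp.memLp f).eLpNorm_eq_integral_rpow_norm (by simp; linarith)
    ENNReal.ofReal_ne_top, ENNReal.toReal_ofReal hp0.le, ENNReal.toReal_ofReal (by positivity),
    ← Real.rpow_mul (by positivity), inv_mul_cancel₀ hp0.ne', Real.rpow_one]

variable [Fact (1 ≤ ENNReal.ofReal p)]

/-- Hölder with exponents `p` and `p' = p / (p - 1)`, since `‖w‖ ^ (p - 1)` raised to the power `p'`
is `‖w‖ ^ p`. -/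
lemma abs_integral_rpow_mul_inner_le (hp : 1 < p) (w b : Lp H (ENNReal.ofReal p) μ) :
    |∫ x, ‖w x‖ ^ (p - 2) * ⟪w x, b x⟫ ∂μ| ≤ ‖w‖ ^ (p - 1) * ‖b‖ := by
  have hp0 : 0 < p := by linarith
  have hp1 : 0 < p - 1 := by linarith
  have hpq : p.HolderConjugate (Real.conjExponent p) := Real.HolderConjugate.conjExponent hp
  have hq : MemLp (fun x => ‖w x‖ ^ (p - 1)) (ENNReal.ofReal (Real.conjExponent p)) μ := by
    have h := (Lp.memLp w).norm_rpow_div (ENNReal.ofReal (p - 1))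
    rw [ENNReal.toReal_ofReal hp1.le, ← ENNReal.ofReal_div_of_pos hp1] at h
    exact h
  have hint : Integrable (fun x => ‖w x‖ ^ (p - 1) * ‖b x‖) μ := by
    have : ENNReal.HolderConjugate (ENNReal.ofReal (Real.conjExponent p)) (ENNReal.ofReal p) :=
      hpq.symm.ennrealOfReal
    exact hq.integrable_mul (Lp.memLp b).norm
  calc |∫ x, ‖w x‖ ^ (p - 2) * ⟪w x, b x⟫ ∂μ|
      ≤ ∫ x, ‖w x‖ ^ (p - 1) * ‖b x‖ ∂μ := by
        refine (abs_integral_le_integral_abs).trans (integral_mono_of_nonneg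
          (Eventually.of_forall fun x => abs_nonneg _) hint
          (Eventually.of_forall fun x => abs_rpow_mul_inner_le _ _ hp))
    _ = ∫ x, ‖(‖b x‖ : ℝ)‖ * ‖‖w x‖ ^ (p - 1)‖ ∂μ := by
        refine integral_congr_ae (Eventually.of_forall fun x => ?_)
        simp only [norm_norm]
        rw [Real.norm_of_nonneg (by positivity), mul_comm]
    _ ≤ (∫ x, ‖(‖b x‖ : ℝ)‖ ^ p ∂μ) ^ (1 / p) *
          (∫ x, ‖‖w x‖ ^ (p - 1)‖ ^ (Real.conjExponent p) ∂μ) ^ (1 / Real.conjExponent p) :=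
        integral_mul_norm_le_Lp_mul_Lq hpq (Lp.memLp b).norm hq
    _ = (‖b‖ ^ p) ^ (1 / p) * (‖w‖ ^ p) ^ (1 / Real.conjExponent p) := by
        rw [norm_Lp_rpow hp, norm_Lp_rpow hp]
        congr 2
        · simp
        · refine integral_congr_ae (Eventually.of_forall fun x => ?_)
          simp only
          rw [Real.norm_of_nonneg (by positivity), ← Real.rpow_mul (norm_nonneg _)]
          congr 1
          rw [Real.conjExponent]; field_simp
    _ = _ := by
        rw [← Real.rpow_mul (norm_nonneg _), ← Real.rpow_mul (norm_nonneg _), mul_one_div_cancel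
          hp0.ne', Real.rpow_one, mul_comm, Real.conjExponent]
        congr 2
        field_simp

/-- The functional `b ↦ ∫ ‖w‖ ^ (p - 2) ⟪w, b⟫` on `L^p`, the derivative of `p⁻¹ ‖·‖ ^ p` at `w`. -/
noncomputable def dualityMap (hp : 1 < p) (w : Lp H (ENNReal.ofReal p) μ) :
    Lp H (ENNReal.ofReal p) μ →L[ℝ] ℝ :=
  LinearMap.mkContinuous
    { toFun := fun b => ∫ x, ‖w x‖ ^ (p - 2) * ⟪w x, b x⟫ ∂μ
      map_add' := fun a b => by
        rw [← integral_add (integrable_rpow_mul_inner hp (Lp.memLp w) (Lp.memLp a))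
          (integrable_rpow_mul_inner hp (Lp.memLp w) (Lp.memLp b))]
        refine integral_congr_ae ?_
        filter_upwards [Lp.coeFn_add a b] with x hx
        rw [hx, Pi.add_apply, inner_add_right, mul_add]
      map_smul' := fun c b => by
        rw [RingHom.id_apply, smul_eq_mul, ← integral_const_mul]
        refine integral_congr_ae ?_
        filter_upwards [Lp.coeFn_smul c b] with x hx
        rw [hx, Pi.smul_apply, real_inner_smul_right]
        ring }
    (‖w‖ ^ (p - 1)) fun b => abs_integral_rpow_mul_inner_le hp w b

lemma dualityMap_apply (hp : 1 < p) (w b : Lp H (ENNReal.ofReal p) μ) :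
    dualityMap hp w b = ∫ x, ‖w x‖ ^ (p - 2) * ⟪w x, b x⟫ ∂μ := rfl

lemma abs_dualityMap_le (hp : 1 < p) (w b : Lp H (ENNReal.ofReal p) μ) :
    |dualityMap hp w b| ≤ ‖w‖ ^ (p - 1) * ‖b‖ := abs_integral_rpow_mul_inner_le hp w b

lemma dualityMap_self (hp : 1 < p) (w : Lp H (ENNReal.ofReal p) μ) :
    dualityMap hp w w = ‖w‖ ^ p := by
  rw [dualityMap_apply, norm_Lp_rpow hp]
  refine integral_congr_ae (Eventually.of_forall fun x => ?_)
  simp only [real_inner_self_eq_norm_sq]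
  rw [← Real.rpow_natCast, ← Real.rpow_add' (norm_nonneg _) (by norm_num; linarith)]
  norm_num

lemma hasDerivAt_norm_add_smul_rpow (hp : 1 < p) (w b : Lp H (ENNReal.ofReal p) μ) :
    HasDerivAt (fun t : ℝ => ‖w + t • b‖ ^ p / p) (dualityMap hp w b) 0 := by
  have hp0 : 0 < p := by linarith
  have hw := Lp.memLp w
  have hb := Lp.memLp b
  have hF : ∀ t : ℝ, ‖w + t • b‖ ^ p = ∫ x, ‖w x + t • b x‖ ^ p ∂μ := by
    intro t
    rw [norm_Lp_rpow hp]
    refine integral_congr_ae ?_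
    filter_upwards [Lp.coeFn_add w (t • b), Lp.coeFn_smul t b] with x hx hx'
    rw [hx, Pi.add_apply, hx', Pi.smul_apply]
  have hmem : ∀ t : ℝ, MemLp (fun x => w x + t • b x) (ENNReal.ofReal p) μ :=
    fun t => hw.add (hb.const_smul t)
  have hpt : ∀ (x : α) (t : ℝ), HasDerivAt (fun t : ℝ => ‖w x + t • b x‖ ^ p)
      (p * (‖w x + t • b x‖ ^ (p - 2) * ⟪w x + t • b x, b x⟫)) t := by
    intro x t
    have h1 : HasDerivAt (fun t : ℝ => w x + t • b x) (b x) t := by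
      simpa using ((hasDerivAt_id t).smul_const (b x)).const_add (w x)
    have h2 := (hasFDerivAt_norm_rpow (w x + t • b x) hp).comp_hasDerivAt t h1
    refine h2.congr_deriv ?_
    rw [smul_apply, innerSL_apply_apply, smul_eq_mul, mul_assoc]
  have key := hasDerivAt_integral_of_dominated_loc_of_deriv_le (μ := μ) (𝕜 := ℝ)
    (F := fun t x => ‖w x + t • b x‖ ^ p)
    (F' := fun t x => p * (‖w x + t • b x‖ ^ (p - 2) * ⟪w x + t • b x, b x⟫))
    -- For `|t| < 1`, `‖w + t b‖ ≤ ‖w‖ + ‖b‖`; the second `‖b‖` comes from `rpow_sub_one_mul_le`.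
    (bound := fun x => p * ‖(‖w x‖ + ‖b x‖) + ‖b x‖‖ ^ p) (x₀ := 0)
    (Metric.ball_mem_nhds (0 : ℝ) one_pos)
    (Eventually.of_forall fun t => (integrable_norm_rpow_of_memLp hp (hmem t)).1)
    (integrable_norm_rpow_of_memLp hp (hmem 0))
    ((integrable_rpow_mul_inner hp (hmem 0) hb).const_mul p).1
    (Eventually.of_forall fun x t ht => by
      rw [Real.norm_eq_abs, abs_mul, abs_of_pos hp0]
      gcongr
      refine (abs_rpow_mul_inner_le _ _ hp).trans ?_
      rw [Real.norm_of_nonneg (by positivity)]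
      refine le_trans ?_ (rpow_sub_one_mul_le (by positivity) (norm_nonneg _) hp)
      have h1 : ‖w x + t • b x‖ ≤ ‖w x‖ + ‖b x‖ := by
        refine (norm_add_le _ _).trans ?_
        gcongr
        rw [norm_smul]
        have : ‖t‖ ≤ 1 := by simpa using (Metric.mem_ball.1 ht).le
        exact mul_le_of_le_one_left (norm_nonneg _) this
      gcongr)
    ((integrable_norm_rpow_of_memLp hp ((hw.norm.add hb.norm).add hb.norm)).const_mul p)
    (Eventually.of_forall fun x t _ => hpt x t)
  have h3 := key.2.div_const p
  simp only [← hF] at h3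
  refine h3.congr_deriv ?_
  rw [integral_const_mul, mul_div_cancel_left₀ _ hp0.ne', dualityMap_apply]
  simp

/-- The inequality is linear in the `p`-th powers and its constant does not depend on the point, so
it integrates. -/
lemma uniformlyConvexPower_Lp [FiniteDimensional ℝ H] (hp : 1 < p) :
    UniformlyConvexPower p (Lp H (ENNReal.ofReal p) μ) := by
  intro ε hε
  obtain ⟨C, hC0, hC⟩ := uniformlyConvexPower_of_finiteDimensional (H := H) hp ε hε
  refine ⟨C, hC0, fun a b => ?_⟩
  have hi := fun f : Lp H (ENNReal.ofReal p) μ => integrable_norm_rpow_of_memLp hp (Lp.memLp f)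
  have h1 : Integrable (fun x => ‖a x‖ ^ p + ‖b x‖ ^ p) μ := (hi a).add (hi b)
  have h2 : Integrable (fun x => (‖a x‖ ^ p + ‖b x‖ ^ p) / 2 -
      ‖((1 / 2 : ℝ) • (a + b)) x‖ ^ p) μ := (h1.div_const 2).sub (hi _)
  rw [norm_Lp_rpow hp, norm_Lp_rpow hp, norm_Lp_rpow hp, norm_Lp_rpow hp,
    ← integral_add (hi a) (hi b), ← integral_const_mul, ← integral_div,
    ← integral_sub (h1.div_const 2) (hi _), ← integral_const_mul,
    ← integral_add (h1.const_mul _) (h2.const_mul _)]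
  refine integral_mono_ae (hi _) ((h1.const_mul _).add (h2.const_mul _)) ?_
  filter_upwards [Lp.coeFn_sub a b, Lp.coeFn_smul (1 / 2 : ℝ) (a + b), Lp.coeFn_add a b]
    with x h3 h4 h5
  rw [h3, h4, Pi.smul_apply, h5]
  exact hC (a x) (b x)

end DualityMap

/-! ### Existence and a priori estimates in product form. -/

section AbstractNeumann

variable {α β : Type*} [MeasurableSpace α] [MeasurableSpace β] {μ : Measure α} {ν : Measure β}
  {H₁ H₂ : Type*} [NormedAddCommGroup H₁] [InnerProductSpace ℝ H₁]
  [NormedAddCommGroup H₂] [InnerProductSpace ℝ H₂] {p : ℝ} [Fact (1 ≤ ENNReal.ofReal p)]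

/-- The Euler–Lagrange equation of the minimizer, obtained by varying it along lines in `M`. -/
lemma exists_dualityMap_eq_neg [FiniteDimensional ℝ H₂] (hp : 1 < p)
    (M : Submodule ℝ (Lp H₁ (ENNReal.ofReal p) μ × Lp H₂ (ENNReal.ofReal p) ν))
    (hM : IsComplete (M : Set (Lp H₁ (ENNReal.ofReal p) μ × Lp H₂ (ENNReal.ofReal p) ν)))
    {K : ℝ} (hK0 : 0 ≤ K) (hK : ∀ z ∈ M, ‖z.1‖ ≤ K * ‖z.2‖)
    (ℓ : Lp H₁ (ENNReal.ofReal p) μ →L[ℝ] ℝ) :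
    ∃ z ∈ M, ∀ w ∈ M, dualityMap hp z.2 w.2 = -ℓ w.1 := by
  obtain ⟨z, hz, hmin⟩ := exists_minimizer hp (uniformlyConvexPower_Lp hp) M hM ℓ hK0 hK
  refine ⟨z, hz, fun w hw => ?_⟩
  have h1 : HasDerivAt (fun t : ℝ => ‖z.2 + t • w.2‖ ^ p / p + (ℓ z.1 + t * ℓ w.1))
      (dualityMap hp z.2 w.2 + ℓ w.1) 0 := by
    refine (hasDerivAt_norm_add_smul_rpow hp z.2 w.2).add ?_
    simpa using ((hasDerivAt_id (0 : ℝ)).mul_const (ℓ w.1)).const_add (ℓ z.1)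
  have h2 : IsLocalMin (fun t : ℝ => ‖z.2 + t • w.2‖ ^ p / p + (ℓ z.1 + t * ℓ w.1)) 0 := by
    refine Eventually.of_forall fun t => ?_
    have := hmin _ (M.add_mem hz (M.smul_mem t hw))
    simpa using this
  linarith [h2.hasDerivAt_eq_zero h1]

/-- The solution tested with itself gives `‖z.2‖ ^ p ≤ ‖f‖ ^ (p - 1) * ‖z.1‖`, which combines with
`‖z.1‖ ^ p ≤ K ^ p * ‖z.2‖ ^ p`. -/
lemma norm_fst_le_of_dualityMap_eq_neg (hp : 1 < p) {K : ℝ} (hK0 : 0 ≤ K)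
    {z : Lp H₁ (ENNReal.ofReal p) μ × Lp H₂ (ENNReal.ofReal p) ν} (hK : ‖z.1‖ ≤ K * ‖z.2‖)
    {f : Lp H₁ (ENNReal.ofReal p) μ} (hz : dualityMap hp z.2 z.2 = -dualityMap hp f z.1) :
    ‖z.1‖ ≤ K ^ (p / (p - 1)) * ‖f‖ := by
  have hp1 : 0 < p - 1 := by linarith
  rcases (norm_nonneg z.1).eq_or_lt with h0 | h0
  · rw [← h0]; positivity
  have h1 : ‖z.2‖ ^ p ≤ ‖f‖ ^ (p - 1) * ‖z.1‖ := by
    rw [← dualityMap_self hp, hz]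
    exact (neg_le_abs _).trans (abs_dualityMap_le hp f z.1)
  have h2 : ‖z.1‖ ^ (p - 1) * ‖z.1‖ ≤ K ^ p * ‖f‖ ^ (p - 1) * ‖z.1‖ := by
    calc ‖z.1‖ ^ (p - 1) * ‖z.1‖ = ‖z.1‖ ^ p := by rw [← Real.rpow_add_one h0.ne']; ring_nf
      _ ≤ (K * ‖z.2‖) ^ p := by gcongr
      _ = K ^ p * ‖z.2‖ ^ p := Real.mul_rpow hK0 (norm_nonneg _)
      _ ≤ K ^ p * (‖f‖ ^ (p - 1) * ‖z.1‖) := by gcongr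
      _ = _ := by ring
  have h3 := le_of_mul_le_mul_right h2 h0
  refine (Real.rpow_le_rpow_iff (norm_nonneg _) (by positivity) hp1).1 (h3.trans_eq ?_)
  rw [Real.mul_rpow (by positivity) (norm_nonneg _), ← Real.rpow_mul hK0,
    div_mul_cancel₀ _ hp1.ne']

/-- `hz` and `hC` bound `‖z.2‖ ^ p` by `C * ‖f‖ ^ p`; `hb` gives `‖f‖ ^ p ≤ ‖z.2‖ ^ (p - 1) * ‖b‖`.
Then `‖f‖ ^ (p - 1)` cancels. -/
lemma norm_le_of_dualityMap_eq_neg (hp : 1 < p) {C : ℝ} (hC0 : 0 ≤ C)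
    {z : Lp H₁ (ENNReal.ofReal p) μ × Lp H₂ (ENNReal.ofReal p) ν}
    {f : Lp H₁ (ENNReal.ofReal p) μ} {b : Lp H₂ (ENNReal.ofReal p) ν}
    (hz : dualityMap hp z.2 z.2 = -dualityMap hp f z.1)
    (hb : dualityMap hp z.2 b = -dualityMap hp f f) (hC : ‖z.1‖ ≤ C * ‖f‖) :
    ‖f‖ ≤ C ^ ((p - 1) / p) * ‖b‖ := by
  have hp0 : 0 < p := by linarith
  have hp1 : 0 < p - 1 := by linarith
  rcases (norm_nonneg f).eq_or_lt with h0 | h0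
  · rw [← h0]; positivity
  have h1 : ‖z.2‖ ^ p ≤ C * ‖f‖ ^ p := by
    calc ‖z.2‖ ^ p ≤ ‖f‖ ^ (p - 1) * ‖z.1‖ := by
          rw [← dualityMap_self hp, hz]
          exact (neg_le_abs _).trans (abs_dualityMap_le hp f z.1)
      _ ≤ ‖f‖ ^ (p - 1) * (C * ‖f‖) := by gcongr
      _ = C * (‖f‖ ^ (p - 1) * ‖f‖) := by ring
      _ = _ := by rw [← Real.rpow_add_one h0.ne']; ring_nf
  have h2 : ‖z.2‖ ^ (p - 1) ≤ C ^ ((p - 1) / p) * ‖f‖ ^ (p - 1) := by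
    have h := Real.rpow_le_rpow (by positivity) h1 (show 0 ≤ (p - 1) / p by positivity)
    rwa [Real.mul_rpow hC0 (by positivity), ← Real.rpow_mul (norm_nonneg _),
      ← Real.rpow_mul (norm_nonneg _), mul_div_cancel₀ _ hp0.ne'] at h
  have h3 : ‖f‖ ^ (p - 1) * ‖f‖ ≤ ‖f‖ ^ (p - 1) * (C ^ ((p - 1) / p) * ‖b‖) := by
    calc ‖f‖ ^ (p - 1) * ‖f‖ = ‖f‖ ^ p := by rw [← Real.rpow_add_one h0.ne']; ring_nf
      _ = |dualityMap hp z.2 b| := by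
          rw [hb, dualityMap_self hp, abs_neg, abs_of_nonneg (by positivity)]
      _ ≤ ‖z.2‖ ^ (p - 1) * ‖b‖ := abs_dualityMap_le hp _ _
      _ ≤ C ^ ((p - 1) / p) * ‖f‖ ^ (p - 1) * ‖b‖ := by gcongr
      _ = _ := by ring
  exact le_of_mul_le_mul_left h3 (by positivity)

end AbstractNeumann

/-! ### Measurable square roots and lifting through them. -/

section SquareRoot

open scoped RealInnerProductSpace

section
open scoped Matrix.Norms.L2Operator MatrixOrder

/-- The square root of a positive semidefinite matrix, as an operator; zero for other matrices. -/
noncomputable def sqrtCLM {n : ℕ} (A : Matrix (Fin n) (Fin n) ℝ) : Rn n →L[ℝ] Rn n :=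
  open Classical in if 0 ≤ A then Matrix.toEuclideanCLM (n := Fin n) (𝕜 := ℝ) (CFC.sqrt A) else 0

/-- The zero convention removes any hypothesis on `A`; the lifting lemma asks for positivity at
every point. -/
lemma sqrtCLM_isPositive {n : ℕ} (A : Matrix (Fin n) (Fin n) ℝ) : (sqrtCLM A).IsPositive := by
  unfold sqrtCLM
  split_ifs with h
  · have h1 : (CFC.sqrt A).PosSemidef := Matrix.nonneg_iff_posSemidef.1 (CFC.sqrt_nonneg A)
    have h2 := Matrix.isPositive_toEuclideanLin_iff.2 h1
    exact (ContinuousLinearMap.isPositive_toLinearMap_iff _).1 h2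
  · exact ContinuousLinearMap.isPositive_zero

lemma inner_sqrtCLM {n : ℕ} {A : Matrix (Fin n) (Fin n) ℝ} (hA : A.PosSemidef) (ξ η : Rn n) :
    ⟪sqrtCLM A ξ, sqrtCLM A η⟫ = ξ.ofLp ⬝ᵥ (A *ᵥ η.ofLp) := by
  have h0 : 0 ≤ A := Matrix.nonneg_iff_posSemidef.2 hA
  have h1 : sqrtCLM A * sqrtCLM A = Matrix.toEuclideanCLM (n := Fin n) (𝕜 := ℝ) A := by
    rw [sqrtCLM, if_pos h0, ← map_mul, CFC.sqrt_mul_sqrt_self A h0]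
  rw [← Matrix.inner_toEuclideanCLM, ← h1]
  exact (sqrtCLM_isPositive A).isSymmetric ξ (sqrtCLM A η)

lemma isClosed_nonneg_matrix {n : ℕ} : IsClosed {A : Matrix (Fin n) (Fin n) ℝ | 0 ≤ A} := by
  have h : {A : Matrix (Fin n) (Fin n) ℝ | 0 ≤ A} =
      {A | Aᴴ = A} ∩ ⋂ x : Fin n → ℝ, {A | 0 ≤ star x ⬝ᵥ (A *ᵥ x)} := by
    ext A
    simp only [mem_ofPred_eq, mem_inter_iff, mem_iInter]
    rw [Matrix.nonneg_iff_posSemidef, Matrix.posSemidef_iff_dotProduct_mulVec]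
    rfl
  rw [h]
  refine (isClosed_eq (by fun_prop) continuous_id).inter (isClosed_iInter fun x => ?_)
  exact isClosed_le continuous_const (by fun_prop)

/-- The square root is continuous on the closed cone of positive semidefinite matrices and is
extended by zero, hence is Borel. -/
lemma aemeasurable_sqrtCLM {α : Type*} [MeasurableSpace α] {ν : Measure α} {n : ℕ}
    {A : α → Matrix (Fin n) (Fin n) ℝ} (hA : ∀ i j, AEMeasurable (fun x => A x i j) ν) :
    AEMeasurable (fun x => sqrtCLM (A x)) ν := by
  classical
  let _ : MeasurableSpace (Matrix (Fin n) (Fin n) ℝ) :=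
    inferInstanceAs (MeasurableSpace (Fin n → Fin n → ℝ))
  have _ : BorelSpace (Matrix (Fin n) (Fin n) ℝ) :=
    inferInstanceAs (BorelSpace (Fin n → Fin n → ℝ))
  have h : ContinuousOn (fun A : Matrix (Fin n) (Fin n) ℝ =>
      Matrix.toEuclideanCLM (n := Fin n) (𝕜 := ℝ) (CFC.sqrt A)) {A | 0 ≤ A} := by
    have : Continuous (Matrix.toEuclideanCLM (n := Fin n) (𝕜 := ℝ)) :=
      LinearMap.continuous_of_finiteDimensional
        ((Matrix.toEuclideanCLM (n := Fin n) (𝕜 := ℝ)).toAlgEquiv.toLinearMap)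
    exact this.comp_continuousOn CFC.continuousOn_sqrt
  have hc : MeasurableSet {A : Matrix (Fin n) (Fin n) ℝ | 0 ≤ A} :=
    isClosed_nonneg_matrix.measurableSet
  have hm : Measurable (sqrtCLM : Matrix (Fin n) (Fin n) ℝ → Rn n →L[ℝ] Rn n) := by
    have := h.measurable_piecewise (g := fun _ => 0) continuousOn_const hc
    convert this using 1
    ext1 A
    simp only [sqrtCLM, piecewise, mem_ofPred_eq]
  exact hm.comp_aemeasurable (aemeasurable_pi_lambda _ fun i => aemeasurable_pi_lambda _ (hA i))

end

lemma isUnit_add_smul_one_of_isPositive {n : ℕ} {T : Rn n →L[ℝ] Rn n} (hT : T.IsPositive) {ε : ℝ}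
    (hε : 0 < ε) : IsUnit (T + ε • (1 : Rn n →L[ℝ] Rn n)) := by
  rw [ContinuousLinearMap.isUnit_iff_bijective]
  have hinj : Function.Injective (T + ε • (1 : Rn n →L[ℝ] Rn n)) := by
    rw [injective_iff_map_eq_zero]
    intro y hy
    have h1 : ⟪T y, y⟫ + ε * ‖y‖ ^ 2 = 0 := by
      rw [← real_inner_self_eq_norm_sq, ← real_inner_smul_left, ← inner_add_left]
      have : T y + ε • y = 0 := by simpa using hy
      rw [this, inner_zero_left]
    have h2 : 0 ≤ ⟪T y, y⟫ := hT.inner_nonneg_left y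
    have h3 : ‖y‖ ^ 2 = 0 := by
      have := sq_nonneg ‖y‖
      nlinarith
    simpa using h3
  exact ⟨hinj, LinearMap.injective_iff_surjective.1 hinj⟩

/-- `T` is self-adjoint, so the orthogonal complement of its range is its kernel; only the range
component of `ξ` matters. -/
lemma exists_apply_apply_eq_of_isPositive {n : ℕ} {T : Rn n →L[ℝ] Rn n} (hT : T.IsPositive)
    (ξ : Rn n) : ∃ η, T (T η) = T ξ := by
  obtain ⟨y, hy, z, hz, rfl⟩ := T.range.exists_add_mem_mem_orthogonal ξ
  obtain ⟨η, rfl⟩ := hy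
  rw [ContinuousLinearMap.orthogonal_range, hT.isSelfAdjoint.adjoint_eq] at hz
  have : T z = 0 := hz
  exact ⟨η, by simp [this]⟩

/-- Regularized inverses of a positive operator `T` applied to a vector of the range of `T`
converge to a preimage of this vector. -/
lemma exists_tendsto_inverse_apply {n : ℕ} {T : Rn n →L[ℝ] Rn n} (hT : T.IsPositive)
    {h : Rn n} (hh : h ∈ Set.range T) :
    ∃ ξ, Tendsto (fun k : ℕ => Ring.inverse (T + (1 / ((k : ℝ) + 1)) • (1 : Rn n →L[ℝ] Rn n)) h)
      atTop (𝓝 ξ) ∧ T ξ = h := by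
  obtain ⟨ξ₀, rfl⟩ := hh
  obtain ⟨η, hη⟩ := exists_apply_apply_eq_of_isPositive hT ξ₀
  refine ⟨T η, ?_, hη⟩
  rw [tendsto_iff_norm_sub_tendsto_zero]
  refine squeeze_zero (g := fun k : ℕ => 1 / ((k : ℝ) + 1) * ‖η‖) (fun _ => norm_nonneg _)
    (fun k => ?_) (by simpa using
      (tendsto_one_div_add_atTop_nhds_zero_nat (𝕜 := ℝ)).mul_const ‖η‖)
  set ε : ℝ := 1 / ((k : ℝ) + 1)
  have hε : 0 < ε := by positivity
  have hu := isUnit_add_smul_one_of_isPositive hT hε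
  set U := T + ε • (1 : Rn n →L[ℝ] Rn n) with hU
  have hinv : ∀ x, Ring.inverse U (U x) = x := fun x => by
    have := Ring.inverse_mul_cancel U hu
    exact congrArg (fun A : Rn n →L[ℝ] Rn n => A x) this
  have hinv' : ∀ x, U (Ring.inverse U x) = x := fun x => by
    have := Ring.mul_inverse_cancel U hu
    exact congrArg (fun A : Rn n →L[ℝ] Rn n => A x) this
  set y := Ring.inverse U (T η) with hy
  have hUx : ∀ x, U x = T x + ε • x := fun x => by simp [hU]
  -- The error is exactly `-ε y` with `y = (T + ε)⁻¹ T η`. Positivity of `T` at `y - η`, where `T (y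
  -- - η) = -ε y`, yields `‖y‖ ≤ ‖η‖`, so the error is at most `ε ‖η‖`.
  have h1 : Ring.inverse U (T ξ₀) - T η = -(ε • y) := by
    have h2 : T ξ₀ = U (T η) - ε • T η := by rw [hUx, hη]; abel
    rw [h2, map_sub, hinv, map_smul, ← hy]; abel
  have h3 : T (y - η) = -(ε • y) := by
    have h4 := hinv' (T η)
    rw [← hy, hUx] at h4
    rw [map_sub, ← h4]; abel
  have h5 : 0 ≤ ⟪T (y - η), y - η⟫ := hT.inner_nonneg_left _
  rw [h3, inner_neg_left, real_inner_smul_left, inner_sub_right, real_inner_self_eq_norm_sq] at h5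
  have h6 : ‖y‖ * ‖y‖ ≤ ‖y‖ * ‖η‖ := by
    have := real_inner_le_norm y η
    have : ‖y‖ ^ 2 - ⟪y, η⟫ ≤ 0 := by
      by_contra! hc
      have := mul_pos hε hc
      linarith
    nlinarith
  have h7 : ‖y‖ ≤ ‖η‖ := by
    rcases (norm_nonneg y).eq_or_lt with h0 | h0
    · rw [← h0]; positivity
    · exact le_of_mul_le_mul_left h6 h0
  rw [h1, norm_neg, norm_smul, Real.norm_of_nonneg hε.le]
  gcongr

lemma measurable_ringInverse {R : Type*} [NormedRing R] [HasSummableGeomSeries R]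
    [MeasurableSpace R] [BorelSpace R] : Measurable (Ring.inverse : R → R) := by
  classical
  have h : ContinuousOn (Ring.inverse : R → R) {x | IsUnit x} := by
    rintro _ ⟨u, rfl⟩
    exact (NormedRing.inverse_continuousAt u).continuousWithinAt
  have := h.measurable_piecewise (g := fun _ => 0) continuousOn_const Units.isOpen.measurableSet
  convert this using 1
  ext1 x
  by_cases hx : IsUnit x
  · simp [piecewise, hx]
  · simp [piecewise, hx]

lemma aemeasurable_clm_apply {α : Type*} [MeasurableSpace α] {ν : Measure α} {n : ℕ}
    {T : α → Rn n →L[ℝ] Rn n} {g : α → Rn n} (hT : AEMeasurable T ν) (hg : AEMeasurable g ν) :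
    AEMeasurable (fun x => T x (g x)) ν := by
  have : Measurable fun z : (Rn n →L[ℝ] Rn n) × Rn n => z.1 z.2 :=
    (continuous_fst.clm_apply continuous_snd).measurable
  exact this.comp_aemeasurable (hT.prodMk hg)

/-- A measurable field with values in the ranges of a measurable field of positive operators lifts
to a measurable field. -/
lemma exists_aemeasurable_lift {α : Type*} [MeasurableSpace α] {ν : Measure α} {n : ℕ}
    {T : α → Rn n →L[ℝ] Rn n} (hT : AEMeasurable T ν) (hTp : ∀ x, (T x).IsPositive)
    {h : α → Rn n} (hh : AEMeasurable h ν) (hr : ∀ᵐ x ∂ν, h x ∈ Set.range (T x)) :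
    ∃ g : α → Rn n, AEMeasurable g ν ∧ ∀ᵐ x ∂ν, T x (g x) = h x := by
  classical
  -- The pointwise choice is measurable because it is an a.e. limit of the measurable regularized
  -- inverses applied to `h`.
  let g : α → Rn n := fun x =>
    if hx : h x ∈ Set.range (T x) then (exists_tendsto_inverse_apply (hTp x) hx).choose else 0
  have hg : ∀ x, h x ∈ Set.range (T x) →
      Tendsto (fun k : ℕ => Ring.inverse (T x + (1 / ((k : ℝ) + 1)) • (1 : Rn n →L[ℝ] Rn n)) (h x))
        atTop (𝓝 (g x)) ∧ T x (g x) = h x := fun x hx => by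
    simp only [g, dif_pos hx]
    exact (exists_tendsto_inverse_apply (hTp x) hx).choose_spec
  refine ⟨g, aemeasurable_of_tendsto_metrizable_ae' (f := fun (k : ℕ) x =>
    Ring.inverse (T x + (1 / ((k : ℝ) + 1)) • (1 : Rn n →L[ℝ] Rn n)) (h x)) (fun k => ?_) ?_, ?_⟩
  · exact aemeasurable_clm_apply (measurable_ringInverse.comp_aemeasurable (hT.add_const _)) hh
  · filter_upwards [hr] with x hx using (hg x hx).1
  · filter_upwards [hr] with x hx using (hg x hx).2

/-- The fields in the ranges of a measurable field of operators form a closed set in `L^p`. -/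
lemma ae_mem_range_of_tendsto {α : Type*} [MeasurableSpace α] {ν : Measure α} {n : ℕ}
    {q : ℝ≥0∞} [Fact (1 ≤ q)] {T : α → Rn n →L[ℝ] Rn n} {b : ℕ → Lp (Rn n) q ν} {h : Lp (Rn n) q ν}
    (hb : ∀ k, ∀ᵐ x ∂ν, b k x ∈ Set.range (T x)) (hlim : Tendsto b atTop (𝓝 h)) :
    ∀ᵐ x ∂ν, h x ∈ Set.range (T x) := by
  obtain ⟨ns, -, hns⟩ := (tendstoInMeasure_of_tendsto_Lp hlim).exists_seq_tendsto_ae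
  filter_upwards [hns, ae_all_iff.2 hb] with x hx hbx
  have : IsClosed (Set.range (T x)) := by
    have := (T x).range.closed_of_finiteDimensional
    rwa [LinearMap.coe_range] at this
  exact this.mem_of_tendsto hx (Eventually.of_forall fun k => hbx _)

end SquareRoot

/-! ### Translation of the weighted spaces and of `C¹(Ē)` into `L^p` terms. -/

section Setup

open scoped RealInnerProductSpace

variable {n : ℕ} {E : Set (Rn n)} {Q : Rn n → Matrix (Fin n) (Fin n) ℝ} {v : Rn n → ℝ} {p : ℝ}

/-- The field `√Q g`. -/
noncomputable def sqrtField (Q : Rn n → Matrix (Fin n) (Fin n) ℝ) (g : Rn n → Rn n) :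
    Rn n → Rn n := fun x => sqrtCLM (Q x) (g x)

lemma bilinForm_eq_inner {x : Rn n} (hQ : (Q x).PosSemidef) (ξ η : Rn n) :
    bilinForm Q x ξ η = ⟪sqrtCLM (Q x) ξ, sqrtCLM (Q x) η⟫ := (inner_sqrtCLM hQ ξ η).symm

lemma quadForm_eq_norm_sq {x : Rn n} (hQ : (Q x).PosSemidef) (ξ : Rn n) :
    quadForm Q x ξ = ‖sqrtCLM (Q x) ξ‖ ^ 2 := by
  rw [quadForm, bilinForm_eq_inner hQ, real_inner_self_eq_norm_sq]

lemma sq_rpow_half {t : ℝ} (ht : 0 ≤ t) (r : ℝ) : (t ^ 2) ^ (r / 2) = t ^ r := by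
  rw [← Real.rpow_natCast, ← Real.rpow_mul ht]
  congr 1
  push_cast
  ring

lemma energyQ_eq_lintegral_enorm (hE : MeasurableSet E) (hQ : ∀ x ∈ E, (Q x).PosSemidef)
    (hp : 1 < p) (g : Rn n → Rn n) :
    energyQ Q p E g = ∫⁻ x in E, ‖sqrtField Q g x‖ₑ ^ p := by
  refine setLIntegral_congr_fun hE fun x hx => ?_
  rw [quadForm_eq_norm_sq (hQ x hx), ENNReal.ofReal_rpow_of_nonneg (by positivity) (by linarith),
    sq_rpow_half (norm_nonneg _), ← ENNReal.ofReal_rpow_of_nonneg (norm_nonneg _) (by linarith),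
    ofReal_norm]
  rfl

lemma normLQ_eq_eLpNorm (hE : MeasurableSet E) (hQ : ∀ x ∈ E, (Q x).PosSemidef)
    (hp : 1 < p) (g : Rn n → Rn n) :
    normLQ Q p E g = eLpNorm (sqrtField Q g) (ENNReal.ofReal p) (volume.restrict E) := by
  rw [normLQ, energyQ_eq_lintegral_enorm hE hQ hp, eLpNorm_eq_lintegral_rpow_enorm_toReal
    (by simp; linarith) ENNReal.ofReal_ne_top, ENNReal.toReal_ofReal (by linarith)]

lemma energyQ_eq_normLQ_rpow (hp : 1 < p) (g : Rn n → Rn n) :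
    energyQ Q p E g = normLQ Q p E g ^ p := by
  rw [normLQ, ← ENNReal.rpow_mul, one_div_mul_cancel (by linarith), ENNReal.rpow_one]

lemma aemeasurable_sqrtField (hQm : ∀ i j, AEMeasurable (fun x => Q x i j) (volume.restrict E))
    {g : Rn n → Rn n} (hg : AEMeasurable g (volume.restrict E)) :
    AEMeasurable (sqrtField Q g) (volume.restrict E) :=
  aemeasurable_clm_apply (aemeasurable_sqrtCLM hQm) hg

lemma MemLQ.memLp (hE : MeasurableSet E) (hQ : ∀ x ∈ E, (Q x).PosSemidef)
    (hQm : ∀ i j, AEMeasurable (fun x => Q x i j) (volume.restrict E)) (hp : 1 < p)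
    {g : Rn n → Rn n} (hg : MemLQ Q p E g) :
    MemLp (sqrtField Q g) (ENNReal.ofReal p) (volume.restrict E) :=
  ⟨(aemeasurable_sqrtField hQm hg.1).aestronglyMeasurable,
    by rw [← normLQ_eq_eLpNorm hE hQ hp]; exact hg.2⟩

lemma memLQ_of_memLp (hE : MeasurableSet E) (hQ : ∀ x ∈ E, (Q x).PosSemidef) (hp : 1 < p)
    {g : Rn n → Rn n} (hg : AEMeasurable g (volume.restrict E))
    (h : MemLp (sqrtField Q g) (ENNReal.ofReal p) (volume.restrict E)) : MemLQ Q p E g :=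
  ⟨hg, by rw [normLQ_eq_eLpNorm hE hQ hp]; exact h.2⟩

lemma gradient_add_of_isC1Closure (hE : IsOpen E) {f g : Rn n → ℝ} (hf : IsC1Closure E f)
    (hg : IsC1Closure E g) {x : Rn n} (hx : x ∈ E) :
    gradient (f + g) x = gradient f x + gradient g x := by
  have h1 := (hf.contDiffOn.differentiableOn one_ne_zero).differentiableAt (hE.mem_nhds hx)
  have h2 := (hg.contDiffOn.differentiableOn one_ne_zero).differentiableAt (hE.mem_nhds hx)
  rw [gradient, fderiv_add h1 h2, map_add]; rfl

lemma gradient_const_smul_of_isC1Closure (c : ℝ) (f : Rn n → ℝ) (x : Rn n) :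
    gradient (c • f) x = c • gradient f x := by
  rw [gradient, fderiv_const_smul_field]; simp [gradient]

lemma gradient_sub_const_eq (f : Rn n → ℝ) (c : ℝ) :
    gradient (fun x => f x - c) = gradient f := by
  ext1 x
  rw [gradient, fderiv_sub_const]; rfl

lemma IsC1Closure.add (hE : IsOpen E) {f g : Rn n → ℝ} (hf : IsC1Closure E f)
    (hg : IsC1Closure E g) : IsC1Closure E (f + g) := by
  obtain ⟨F, hF, hF'⟩ := hf.gradient_extends
  obtain ⟨G, hG, hG'⟩ := hg.gradient_extends
  refine ⟨hf.1.add hg.1, hf.2.add hg.2, F + G, hF.add hG, fun x hx => ?_⟩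
  rw [gradient_add_of_isC1Closure hE hf hg hx, hF' hx, hG' hx]; rfl

lemma IsC1Closure.const_smul {f : Rn n → ℝ} (hf : IsC1Closure E f) (c : ℝ) :
    IsC1Closure E (c • f) := by
  obtain ⟨F, hF, hF'⟩ := hf.gradient_extends
  refine ⟨contDiffOn_const.smul hf.1, hf.2.const_smul c, c • F, hF.const_smul c, fun x hx => ?_⟩
  rw [gradient_const_smul_of_isC1Closure, hF' hx]; rfl

lemma IsC1Closure.sub_const {f : Rn n → ℝ} (hf : IsC1Closure E f) (c : ℝ) :
    IsC1Closure E (fun x => f x - c) :=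
  ⟨hf.1.sub contDiffOn_const, hf.2.sub continuousOn_const, by
    rw [gradient_sub_const_eq]; exact hf.gradient_extends⟩

lemma isC1Closure_zero : IsC1Closure E (0 : Rn n → ℝ) :=
  ⟨contDiffOn_const, continuousOn_const, 0, continuousOn_const, fun x _ => by
    simp [gradient]⟩

lemma IsC1Closure.aemeasurable_gradient (hE : IsOpen E) {f : Rn n → ℝ} (hf : IsC1Closure E f) :
    AEMeasurable (gradient f) (volume.restrict E) := by
  obtain ⟨F, hF, hF'⟩ := hf.gradient_extends
  exact ((hF.mono subset_closure).congr hF').aemeasurable hE.measurableSet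

lemma ae_weightMeasure_of_ae {P : Rn n → Prop} (h : ∀ᵐ x ∂(volume.restrict E), P x) :
    ∀ᵐ x ∂(weightMeasure v E), P x :=
  (withDensity_absolutelyContinuous _ _).ae_le h

/-- Such a function is bounded on the compact closure of `E`, and the weighted measure is finite. -/
lemma IsC1Closure.memLpWeight (hE : IsOpen E) (hEb : Bornology.IsBounded E)
    [IsFiniteMeasure (weightMeasure v E)] {f : Rn n → ℝ} (hf : IsC1Closure E f) :
    MemLpWeight v p E f := by
  obtain ⟨B, hB⟩ := hEb.isCompact_closure.exists_bound_of_continuousOn hf.continuousOn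
  have hm : AEStronglyMeasurable f (weightMeasure v E) :=
    ((hf.continuousOn.mono subset_closure).aestronglyMeasurable hE.measurableSet).mono_ac
      (withDensity_absolutelyContinuous _ _)
  refine MemLp.of_bound hm B (ae_weightMeasure_of_ae ?_)
  filter_upwards [ae_restrict_mem hE.measurableSet] with x hx using hB x (subset_closure hx)

lemma isFiniteMeasure_weightMeasure {Ω : Set (Rn n)} (hEb : Bornology.IsBounded E)
    (hEΩ : closure E ⊆ Ω) (hvi : LocallyIntegrableOn v Ω volume) :
    IsFiniteMeasure (weightMeasure v E) :=
  isFiniteMeasure_withDensity_ofReal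
    ((hvi.integrableOn_compact_subset hEΩ hEb.isCompact_closure).mono_set subset_closure).2

lemma lintegral_abs_rpow_eq_eLpNorm_rpow {α : Type*} [MeasurableSpace α] {μ : Measure α}
    (hp : 1 < p) (f : α → ℝ) :
    ∫⁻ x, ENNReal.ofReal (|f x| ^ p) ∂μ = eLpNorm f (ENNReal.ofReal p) μ ^ p := by
  rw [eLpNorm_eq_lintegral_rpow_enorm_toReal (by simp; linarith) ENNReal.ofReal_ne_top,
    ENNReal.toReal_ofReal (by linarith), ← ENNReal.rpow_mul, one_div_mul_cancel (by linarith),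
    ENNReal.rpow_one]
  refine lintegral_congr fun x => ?_
  rw [← ENNReal.ofReal_rpow_of_nonneg (abs_nonneg _) (by linarith), Real.enorm_eq_ofReal_abs]

lemma ofReal_norm_Lp {α F : Type*} [MeasurableSpace α] {μ : Measure α} [NormedAddCommGroup F]
    {q : ℝ≥0∞} [Fact (1 ≤ q)] {w : Lp F q μ} {f : α → F} (h : w =ᵐ[μ] f) :
    ENNReal.ofReal ‖w‖ = eLpNorm f q μ := by
  rw [ofReal_norm, Lp.enorm_def, eLpNorm_congr_ae h]

/-! ### The mean-zero Sobolev space as a closed subspace. -/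

variable [Fact (1 ≤ ENNReal.ofReal p)]

/-- The pairs `(φ, √Q ∇φ)` for the mean-zero test functions `φ`. -/
noncomputable def testPairs (hE : IsOpen E) (hQ : ∀ x ∈ E, (Q x).PosSemidef)
    (hQm : ∀ i j, AEMeasurable (fun x => Q x i j) (volume.restrict E)) (hp : 1 < p)
    [IsFiniteMeasure (weightMeasure v E)] :
    Submodule ℝ (Lp ℝ (ENNReal.ofReal p) (weightMeasure v E) ×
      Lp (Rn n) (ENNReal.ofReal p) (volume.restrict E)) where
  carrier := {z | ∃ φ : Rn n → ℝ, IsC1Sobolev Q v p E φ ∧ ∫ x, φ x ∂(weightMeasure v E) = 0 ∧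
    z.1 =ᵐ[weightMeasure v E] φ ∧ z.2 =ᵐ[volume.restrict E] sqrtField Q (gradient φ)}
  zero_mem' := by
    have h0 : gradient (0 : Rn n → ℝ) = 0 := by ext1 x; simp [gradient]
    have h1 : sqrtField Q (gradient (0 : Rn n → ℝ)) = 0 := by ext1 x; simp [sqrtField, h0]
    refine ⟨0, ⟨isC1Closure_zero, MemLp.zero, memLQ_of_memLp hE.measurableSet hQ hp ?_ ?_⟩,
      by simp, Lp.coeFn_zero _ _ _, ?_⟩
    · rw [h0]; exact aemeasurable_const
    · rw [h1]; exact MemLp.zero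
    · rw [h1]; exact Lp.coeFn_zero _ _ _
  add_mem' := by
    rintro z w ⟨φ, hφ, hφ0, hz1, hz2⟩ ⟨ψ, hψ, hψ0, hw1, hw2⟩
    have h1 : sqrtField Q (gradient (φ + ψ)) =ᵐ[volume.restrict E]
        sqrtField Q (gradient φ) + sqrtField Q (gradient ψ) := by
      filter_upwards [ae_restrict_mem hE.measurableSet] with x hx
      simp only [sqrtField, Pi.add_apply, gradient_add_of_isC1Closure hE hφ.1 hψ.1 hx, map_add]
    have h2 := hφ.1.add hE hψ.1
    refine ⟨φ + ψ, ⟨h2, hφ.2.1.add hψ.2.1, memLQ_of_memLp hE.measurableSet hQ hp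
      (h2.aemeasurable_gradient hE) ((memLp_congr_ae h1).2
        ((hφ.2.2.memLp hE.measurableSet hQ hQm hp).add
          (hψ.2.2.memLp hE.measurableSet hQ hQm hp)))⟩, ?_, ?_, ?_⟩
    · simp only [Pi.add_apply]
      rw [integral_add (hφ.2.1.integrable Fact.out) (hψ.2.1.integrable Fact.out), hφ0, hψ0, add_zero]
    · exact (Lp.coeFn_add z.1 w.1).trans (hz1.add hw1)
    · exact ((Lp.coeFn_add z.2 w.2).trans (hz2.add hw2)).trans h1.symm
  smul_mem' := by
    rintro c z ⟨φ, hφ, hφ0, hz1, hz2⟩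
    have h1 : sqrtField Q (gradient (c • φ)) = c • sqrtField Q (gradient φ) := by
      ext1 x
      simp only [sqrtField, Pi.smul_apply, gradient_const_smul_of_isC1Closure, map_smul]
    have h2 := hφ.1.const_smul c
    refine ⟨c • φ, ⟨h2, hφ.2.1.const_smul c, memLQ_of_memLp hE.measurableSet hQ hp
      (h2.aemeasurable_gradient hE) ?_⟩, ?_, ?_, ?_⟩
    · rw [h1]
      exact (hφ.2.2.memLp hE.measurableSet hQ hQm hp).const_smul c
    · simp only [Pi.smul_apply]
      rw [integral_smul, hφ0, smul_zero]
    · exact (Lp.coeFn_smul c z.1).trans (hz1.const_smul c)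
    · rw [h1]
      exact (Lp.coeFn_smul c z.2).trans (hz2.const_smul c)

variable (hE : IsOpen E) (hQ : ∀ x ∈ E, (Q x).PosSemidef)
  (hQm : ∀ i j, AEMeasurable (fun x => Q x i j) (volume.restrict E)) (hp : 1 < p)
  [IsFiniteMeasure (weightMeasure v E)]

/-- This exhibits the integral as a continuous functional on `L^p`, so means can be subtracted and
passed to limits. -/
lemma dualityMap_one_apply {α : Type*} [MeasurableSpace α] {μ : Measure α} [IsFiniteMeasure μ]
    (hp : 1 < p) (a : Lp ℝ (ENNReal.ofReal p) μ) :
    dualityMap hp ((memLp_const (1 : ℝ)).toLp (fun _ => (1 : ℝ))) a = ∫ x, a x ∂μ := by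
  rw [dualityMap_apply]
  refine integral_congr_ae ?_
  filter_upwards [(memLp_const (μ := μ) (p := ENNReal.ofReal p) (1 : ℝ)).coeFn_toLp] with x hx
  rw [hx]; simp

/-- An element of the mean-zero Sobolev space gives a limit of pairs of test functions. -/
lemma mem_topologicalClosure_of_memSobolevMeanZero {u : Rn n → ℝ} {g : Rn n → Rn n}
    {z : Lp ℝ (ENNReal.ofReal p) (weightMeasure v E) ×
      Lp (Rn n) (ENNReal.ofReal p) (volume.restrict E)}
    (h : MemSobolevMeanZero Q v p E u g) (hz1 : z.1 =ᵐ[weightMeasure v E] u)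
    (hz2 : z.2 =ᵐ[volume.restrict E] sqrtField Q g) :
    z ∈ (testPairs (v := v) hE hQ hQm hp).topologicalClosure := by
  obtain ⟨⟨hu, hg, φ, hφ, hφu, hφg⟩, hu0⟩ := h
  have hmz := hg.memLp hE.measurableSet hQ hQm hp
  obtain rfl : z = (hu.toLp u, hmz.toLp (sqrtField Q g)) :=
    Prod.ext (Lp.ext (hz1.trans hu.coeFn_toLp.symm)) (Lp.ext (hz2.trans hmz.coeFn_toLp.symm))
  set one : Lp ℝ (ENNReal.ofReal p) (weightMeasure v E) :=
    (memLp_const (1 : ℝ)).toLp (fun _ => (1 : ℝ)) with hone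
  -- `L` subtracts the mean: it fixes `u`, turns the approximants into mean-zero ones and leaves
  -- their gradients unchanged. If `v(E) = 0`, the inverse is `0`, in agreement with the average.
  set L : Lp ℝ (ENNReal.ofReal p) (weightMeasure v E) → Lp ℝ (ENNReal.ofReal p) (weightMeasure v E) :=
    fun a => a - (((weightMeasure v E).real univ)⁻¹ * dualityMap hp one a) • one with hL
  have hLc : Continuous L := by fun_prop
  set a : ℕ → Lp ℝ (ENNReal.ofReal p) (weightMeasure v E) := fun k => (hφ k).2.1.toLp (φ k)
  have ha : Tendsto a atTop (𝓝 (hu.toLp u)) := by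
    rw [Lp.tendsto_Lp_iff_tendsto_eLpNorm'' _ (fun k => (hφ k).2.1) _ hu]
    exact hφu
  have hmg : ∀ k, MemLp (sqrtField Q (gradient (φ k))) (ENNReal.ofReal p) (volume.restrict E) :=
    fun k => (hφ k).2.2.memLp hE.measurableSet hQ hQm hp
  have hb : Tendsto (fun k => (hmg k).toLp _) atTop
      (𝓝 (hmz.toLp (sqrtField Q g))) := by
    rw [Lp.tendsto_Lp_iff_tendsto_eLpNorm'' _ hmg _ _]
    refine hφg.congr fun k => ?_
    rw [normLQ_eq_eLpNorm hE.measurableSet hQ hp]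
    congr 1
    ext1 x
    simp [sqrtField]
  have hLu : L (hu.toLp u) = hu.toLp u := by
    have : dualityMap hp one (hu.toLp u) = 0 := by
      rw [hone, dualityMap_one_apply, ← hu0]
      exact integral_congr_ae hu.coeFn_toLp
    simp [hL, this]
  have hlim := ((hLc.tendsto _).comp ha).prodMk_nhds hb
  rw [hLu] at hlim
  refine mem_closure_of_tendsto hlim (Eventually.of_forall fun k => ?_)
  have hae : dualityMap hp one (a k) = ∫ x, φ k x ∂(weightMeasure v E) := by
    rw [hone, dualityMap_one_apply]
    exact integral_congr_ae (hφ k).2.1.coeFn_toLp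
  refine ⟨fun x => φ k x - ⨍ y, φ k y ∂(weightMeasure v E), ⟨(hφ k).1.sub_const _,
    (hφ k).2.1.sub (memLp_const _), ?_⟩, integral_sub_average _ _, ?_, ?_⟩
  · rw [gradient_sub_const_eq]; exact (hφ k).2.2
  · simp only [Function.comp_apply, hL, hae]
    filter_upwards [Lp.coeFn_sub (a k) ((((weightMeasure v E).real univ)⁻¹ *
      ∫ x, φ k x ∂(weightMeasure v E)) • one), Lp.coeFn_smul (((weightMeasure v E).real univ)⁻¹ *
      ∫ x, φ k x ∂(weightMeasure v E)) one, (hφ k).2.1.coeFn_toLp,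
      (memLp_const (μ := weightMeasure v E) (p := ENNReal.ofReal p) (1 : ℝ)).coeFn_toLp]
      with x h1 h2 h3 h4
    rw [h1, Pi.sub_apply, h2, Pi.smul_apply, h3, hone, h4, average_eq, smul_eq_mul, smul_eq_mul,
      mul_one]
  · rw [gradient_sub_const_eq]; exact (hmg k).coeFn_toLp

/-- A limit of pairs of test functions comes from an element of the mean-zero Sobolev space. -/
lemma exists_memSobolevMeanZero_of_mem_topologicalClosure
    {z : Lp ℝ (ENNReal.ofReal p) (weightMeasure v E) ×
      Lp (Rn n) (ENNReal.ofReal p) (volume.restrict E)}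
    (hz : z ∈ (testPairs (v := v) hE hQ hQm hp).topologicalClosure) :
    ∃ g : Rn n → Rn n, MemSobolevMeanZero Q v p E z.1 g ∧
      z.2 =ᵐ[volume.restrict E] sqrtField Q g := by
  obtain ⟨w, hw, hlim⟩ := mem_closure_iff_seq_limit.1 hz
  choose φ hφ hφ0 hw1 hw2 using hw
  have h1 : Tendsto (fun k => (w k).1) atTop (𝓝 z.1) := (continuous_fst.tendsto z).comp hlim
  have h2 : Tendsto (fun k => (w k).2) atTop (𝓝 z.2) := (continuous_snd.tendsto z).comp hlim
  -- The limit field stays in the range of `√Q` a.e., so it has the form `√Q g` with `g` measurable.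
  obtain ⟨g, hg, hgz⟩ := exists_aemeasurable_lift (aemeasurable_sqrtCLM hQm)
    (fun x => sqrtCLM_isPositive (Q x)) (Lp.aestronglyMeasurable z.2).aemeasurable
    (ae_mem_range_of_tendsto (fun k => (hw2 k).mono fun x hx => ⟨gradient (φ k) x, hx.symm⟩) h2)
  have hgz' : z.2 =ᵐ[volume.restrict E] sqrtField Q g := hgz.mono fun x hx => hx.symm
  refine ⟨g, ⟨⟨Lp.memLp z.1, memLQ_of_memLp hE.measurableSet hQ hp hg
    ((memLp_congr_ae hgz').1 (Lp.memLp z.2)), φ, hφ, ?_, ?_⟩, ?_⟩, hgz'⟩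
  · refine ((Lp.tendsto_Lp_iff_tendsto_eLpNorm' _ _).1 h1).congr fun k => ?_
    exact eLpNorm_congr_ae ((hw1 k).sub EventuallyEq.rfl)
  · refine ((Lp.tendsto_Lp_iff_tendsto_eLpNorm' _ _).1 h2).congr fun k => ?_
    rw [normLQ_eq_eLpNorm hE.measurableSet hQ hp]
    refine eLpNorm_congr_ae (((hw2 k).sub hgz').trans (Eventually.of_forall fun x => ?_))
    simp [sqrtField]
  · have h3 : ∀ k, dualityMap hp ((memLp_const (1 : ℝ)).toLp (fun _ => (1 : ℝ))) (w k).1 = 0 :=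
      fun k => by
        rw [dualityMap_one_apply, ← hφ0 k]
        exact integral_congr_ae (hw1 k)
    rw [← dualityMap_one_apply hp]
    refine tendsto_nhds_unique (((dualityMap hp _).continuous.tendsto _).comp h1)
      (tendsto_const_nhds.congr fun k => (h3 k).symm)

/-! ### The weak equation and the Poincaré property on the closure. -/

lemma setIntegral_flux_eq_dualityMap (hE : IsOpen E) (hQ : ∀ x ∈ E, (Q x).PosSemidef) (hp : 1 < p)
    {h b : Lp (Rn n) (ENNReal.ofReal p) (volume.restrict E)}
    {g w : Rn n → Rn n} (hg : h =ᵐ[volume.restrict E] sqrtField Q g)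
    (hw : b =ᵐ[volume.restrict E] sqrtField Q w) :
    ∫ x in E, quadForm Q x (g x) ^ ((p - 2) / 2) * bilinForm Q x (w x) (g x) =
      dualityMap hp h b := by
  rw [dualityMap_apply]
  refine integral_congr_ae ?_
  filter_upwards [hg, hw, ae_restrict_mem hE.measurableSet] with x h1 h2 hx
  rw [h1, h2, quadForm_eq_norm_sq (hQ x hx), bilinForm_eq_inner (hQ x hx),
    sq_rpow_half (norm_nonneg _), real_inner_comm]
  rfl

lemma integral_datum_eq_dualityMap {α : Type*} [MeasurableSpace α] {μ : Measure α} (hp : 1 < p)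
    {F a : Lp ℝ (ENNReal.ofReal p) μ} {f φ : α → ℝ} (hF : F =ᵐ[μ] f) (ha : a =ᵐ[μ] φ) :
    ∫ x, |f x| ^ (p - 2) * f x * φ x ∂μ = dualityMap hp F a := by
  rw [dualityMap_apply]
  refine integral_congr_ae ?_
  filter_upwards [hF, ha] with x h1 h2
  rw [h1, h2, Real.norm_eq_abs, mul_assoc]
  simp [mul_comm]

/-- Both sides are continuous in the test pair, so the equation extends to the closure; the solution
itself then becomes an admissible test. -/
lemma isWeakSolution_iff {f u : Rn n → ℝ} {g : Rn n → Rn n}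
    {F : Lp ℝ (ENNReal.ofReal p) (weightMeasure v E)}
    {h : Lp (Rn n) (ENNReal.ofReal p) (volume.restrict E)} (hF : F =ᵐ[weightMeasure v E] f)
    (hh : h =ᵐ[volume.restrict E] sqrtField Q g) :
    IsWeakSolution Q v p E f u g ↔ MemSobolevMeanZero Q v p E u g ∧
      ∀ w ∈ (testPairs (v := v) hE hQ hQm hp).topologicalClosure,
        dualityMap hp h w.2 = -dualityMap hp F w.1 := by
  refine and_congr_right fun _ => ⟨fun H w hw => ?_, fun H φ hφ hφ0 => ?_⟩
  · have hcl : IsClosed {w : Lp ℝ (ENNReal.ofReal p) (weightMeasure v E) ×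
        Lp (Rn n) (ENNReal.ofReal p) (volume.restrict E) |
        dualityMap hp h w.2 = -dualityMap hp F w.1} := isClosed_eq (by fun_prop) (by fun_prop)
    refine closure_minimal ?_ hcl hw
    rintro z ⟨φ, hφ, hφ0, hz1, hz2⟩
    have := H φ hφ hφ0
    rwa [setIntegral_flux_eq_dualityMap hE hQ hp hh hz2,
      integral_datum_eq_dualityMap hp hF hz1] at this
  · have hm := hφ.2.2.memLp hE.measurableSet hQ hQm hp
    have := H (hφ.2.1.toLp φ, hm.toLp _) (subset_closure
      ⟨φ, hφ, hφ0, hφ.2.1.coeFn_toLp, hm.coeFn_toLp⟩)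
    rwa [setIntegral_flux_eq_dualityMap hE hQ hp hh hm.coeFn_toLp,
      integral_datum_eq_dualityMap hp hF hφ.2.1.coeFn_toLp]

/-- Mean-zero test functions give the norm estimate after a `p`-th root, and it is a closed
condition. Conversely, `f` minus its mean is a test function whenever its energy is finite. -/
lemma poincare_iff (hEb : Bornology.IsBounded E) :
    HasPoincareProperty Q v p E ↔ ∃ K : ℝ, 0 ≤ K ∧
      ∀ z ∈ (testPairs (v := v) hE hQ hQm hp).topologicalClosure, ‖z.1‖ ≤ K * ‖z.2‖ := by
  have hp0 : 0 < p := by linarith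
  constructor
  · rintro ⟨C, hC0, hC⟩
    refine ⟨C ^ (1 / p), by positivity, fun z hz => ?_⟩
    have hcl : IsClosed {z : Lp ℝ (ENNReal.ofReal p) (weightMeasure v E) ×
        Lp (Rn n) (ENNReal.ofReal p) (volume.restrict E) | ‖z.1‖ ≤ C ^ (1 / p) * ‖z.2‖} :=
      isClosed_le (by fun_prop) (by fun_prop)
    refine closure_minimal ?_ hcl hz
    rintro z ⟨φ, hφ, hφ0, hz1, hz2⟩
    have h1 := hC φ hφ.1
    have h0 : ⨍ y, φ y ∂(weightMeasure v E) = 0 := by rw [average_eq, hφ0, smul_zero]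
    simp only [h0, sub_zero] at h1
    rw [lintegral_abs_rpow_eq_eLpNorm_rpow hp, energyQ_eq_normLQ_rpow hp,
      normLQ_eq_eLpNorm hE.measurableSet hQ hp, ← ofReal_norm_Lp hz1, ← ofReal_norm_Lp hz2] at h1
    have h2 := ENNReal.rpow_le_rpow h1 (show 0 ≤ 1 / p by positivity)
    rw [ENNReal.mul_rpow_of_nonneg _ _ (by positivity), ← ENNReal.rpow_mul, ← ENNReal.rpow_mul,
      mul_one_div_cancel hp0.ne', ENNReal.rpow_one, ENNReal.rpow_one,
      ENNReal.ofReal_rpow_of_pos hC0, ← ENNReal.ofReal_mul (by positivity)] at h2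
    exact (ENNReal.ofReal_le_ofReal_iff (by positivity)).1 h2
  · rintro ⟨K, hK0, hK⟩
    -- Adding `1` keeps the constant positive when `K = 0`, so that infinite energy gives an
    -- infinite right-hand side.
    refine ⟨K ^ p + 1, by positivity, fun f hf => ?_⟩
    by_cases hfin : energyQ Q p E (gradient f) = ∞
    · rw [hfin, ENNReal.mul_top (by simp; positivity)]
      exact le_top
    have hmf : MemLQ Q p E (gradient f) := ⟨hf.aemeasurable_gradient hE,
      ENNReal.rpow_lt_top_of_nonneg (by positivity) hfin⟩
    set ψ : Rn n → ℝ := fun x => f x - ⨍ y, f y ∂(weightMeasure v E)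
    have hψ : IsC1Closure E ψ := hf.sub_const _
    have hψm : MemLpWeight v p E ψ := hψ.memLpWeight hE hEb
    have hm := hmf.memLp hE.measurableSet hQ hQm hp
    have h1 := hK (hψm.toLp ψ, hm.toLp _) (subset_closure ⟨ψ, ⟨hψ, hψm, by
      rw [gradient_sub_const_eq]; exact hmf⟩, integral_sub_average _ _, hψm.coeFn_toLp, by
      rw [gradient_sub_const_eq]; exact hm.coeFn_toLp⟩)
    rw [lintegral_abs_rpow_eq_eLpNorm_rpow hp, energyQ_eq_normLQ_rpow hp,
      normLQ_eq_eLpNorm hE.measurableSet hQ hp, ← ofReal_norm_Lp hψm.coeFn_toLp,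
      ← ofReal_norm_Lp hm.coeFn_toLp, ENNReal.ofReal_rpow_of_nonneg (norm_nonneg _) hp0.le,
      ENNReal.ofReal_rpow_of_nonneg (norm_nonneg _) hp0.le, ← ENNReal.ofReal_mul (by positivity)]
    refine ENNReal.ofReal_le_ofReal ?_
    calc _ ≤ (K * ‖hm.toLp _‖) ^ p := Real.rpow_le_rpow (norm_nonneg _) h1 hp0.le
      _ = K ^ p * ‖hm.toLp _‖ ^ p := Real.mul_rpow hK0 (norm_nonneg _)
      _ ≤ _ := by gcongr; linarith

/-! ### The two implications. -/

lemma neumann_of_poincare {K : ℝ} (hK0 : 0 ≤ K)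
    (hK : ∀ z ∈ (testPairs (v := v) hE hQ hQm hp).topologicalClosure, ‖z.1‖ ≤ K * ‖z.2‖) :
    HasNeumannProperty Q v p E := by
  refine ⟨fun f hf => ?_, K ^ (p / (p - 1)) + 1, by positivity, fun f hf u g hug => ?_⟩
  · obtain ⟨z, hz, hzw⟩ := exists_dualityMap_eq_neg hp _
      (Submodule.isClosed_topologicalClosure (testPairs (v := v) hE hQ hQm hp)).isComplete hK0 hK
      (dualityMap hp (hf.toLp f))
    obtain ⟨g, hg, hgz⟩ := exists_memSobolevMeanZero_of_mem_topologicalClosure hE hQ hQm hp hz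
    exact ⟨z.1, g, (isWeakSolution_iff hE hQ hQm hp hf.coeFn_toLp hgz).2 ⟨hg, hzw⟩⟩
  · have hu : MemLpWeight v p E u := hug.1.1.1
    have hm := hug.1.1.2.1.memLp hE.measurableSet hQ hQm hp
    have hmem := mem_topologicalClosure_of_memSobolevMeanZero hE hQ hQm hp
      (z := (hu.toLp u, hm.toLp _)) hug.1 hu.coeFn_toLp hm.coeFn_toLp
    have h1 := norm_fst_le_of_dualityMap_eq_neg hp hK0 (hK _ hmem) (f := hf.toLp f)
      (((isWeakSolution_iff hE hQ hQm hp hf.coeFn_toLp hm.coeFn_toLp).1 hug).2 _ hmem)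
    have h2 : ‖hu.toLp u‖ ≤ (K ^ (p / (p - 1)) + 1) * ‖hf.toLp f‖ :=
      h1.trans (by gcongr; linarith)
    have h3 := ENNReal.ofReal_le_ofReal h2
    rwa [ENNReal.ofReal_mul (by positivity), ofReal_norm_Lp hu.coeFn_toLp,
      ofReal_norm_Lp hf.coeFn_toLp] at h3

lemma poincare_of_neumann (hN : HasNeumannProperty Q v p E) : ∃ K : ℝ, 0 ≤ K ∧
    ∀ z ∈ (testPairs (v := v) hE hQ hQm hp).topologicalClosure, ‖z.1‖ ≤ K * ‖z.2‖ := by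
  obtain ⟨hex, C, hC0, hC⟩ := hN
  refine ⟨C ^ ((p - 1) / p), by positivity, fun w hw => ?_⟩
  -- The datum is the first component of the very pair to be estimated.
  obtain ⟨u, g, hug⟩ := hex w.1 (Lp.memLp w.1)
  have hu : MemLpWeight v p E u := hug.1.1.1
  have hm := hug.1.1.2.1.memLp hE.measurableSet hQ hQm hp
  obtain ⟨z, hz1, hz2⟩ : ∃ z : Lp ℝ (ENNReal.ofReal p) (weightMeasure v E) ×
      Lp (Rn n) (ENNReal.ofReal p) (volume.restrict E),
      z.1 =ᵐ[weightMeasure v E] u ∧ z.2 =ᵐ[volume.restrict E] sqrtField Q g :=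
    ⟨(hu.toLp u, hm.toLp _), hu.coeFn_toLp, hm.coeFn_toLp⟩
  have hmem := mem_topologicalClosure_of_memSobolevMeanZero hE hQ hQm hp hug.1 hz1 hz2
  have hid := ((isWeakSolution_iff hE hQ hQm hp (EventuallyEq.refl _ w.1) hz2).1 hug).2
  have h1 : ‖z.1‖ ≤ C * ‖w.1‖ := by
    have h := hC w.1 (Lp.memLp w.1) u g hug
    rw [normLpWeight, normLpWeight, ← ofReal_norm_Lp hz1,
      ← ofReal_norm_Lp (EventuallyEq.refl _ w.1), ← ENNReal.ofReal_mul hC0.le] at h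
    exact (ENNReal.ofReal_le_ofReal_iff (by positivity)).1 h
  exact norm_le_of_dualityMap_eq_neg hp hC0.le (hid _ hmem) (hid _ hw) h1

end Setup

end DegenerateNeumann

theorem theorem1p1 (n : ℕ) (Ω E : Set (DegenerateNeumann.Rn n))
    (hΩ : IsOpen Ω) (hΩc : IsConnected Ω)
    (hE : IsOpen E) (hEb : Bornology.IsBounded E) (hEΩ : closure E ⊆ Ω)
    (Q : DegenerateNeumann.Rn n → Matrix (Fin n) (Fin n) ℝ)
    (hQ : ∀ x ∈ Ω, (Q x).PosSemidef)
    (hQm : ∀ i j, AEMeasurable (fun x => Q x i j) (volume.restrict Ω))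
    (v : DegenerateNeumann.Rn n → ℝ) (hv : ∀ x ∈ Ω, 0 ≤ v x)
    (hvi : LocallyIntegrableOn v Ω volume)
    (p : ℝ) (hp : 1 < p)
    (hγ : LocallyIntegrableOn (fun x => DegenerateNeumann.gammaOp Q x ^ (p / 2)) E volume) :
    DegenerateNeumann.HasNeumannProperty Q v p E ↔
      DegenerateNeumann.HasPoincareProperty Q v p E := by
  have hEΩ' : E ⊆ Ω := subset_closure.trans hEΩ
  have hQE : ∀ x ∈ E, (Q x).PosSemidef := fun x hx => hQ x (hEΩ' hx)
  have hQmE : ∀ i j, AEMeasurable (fun x => Q x i j) (volume.restrict E) :=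
    fun i j => (hQm i j).mono_measure (Measure.restrict_mono hEΩ' le_rfl)
  have : Fact (1 ≤ ENNReal.ofReal p) := ⟨ENNReal.one_le_ofReal.2 hp.le⟩
  have := DegenerateNeumann.isFiniteMeasure_weightMeasure hEb hEΩ hvi
  rw [DegenerateNeumann.poincare_iff hE hQE hQmE hp hEb]
  exact ⟨DegenerateNeumann.poincare_of_neumann hE hQE hQmE hp,
    fun ⟨_, hK0, hK⟩ => DegenerateNeumann.neumann_of_poincare hE hQE hQmE hp hK0 hK⟩
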